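/- All graphs are finite and rigidity is in $\mathbb{R}^3$. A framework $(G,p)$ is *generic* if its rigidity matrix has maximum rank over all frameworks of $G$; it is *rigid* if every framework $(G,q)$ with the same edge lengths and $q$ sufficiently close to $p$ is congruent to it. A graph is *rigid* if it has a generic framework that is rigid, and *nucleation-free* if none of its subgraphs with at least five vertices is rigid. A non-edge $\{u,v\}$ of $G$ is *implied* if, in every generic framework of $G$, the row of the pair $\{u,v\}$ is a linear combination of the rows of the rigidity matrix of $G$. Let $(G,p)$ be a framework. An infinitesimal motion $m$ of it is *expansive* (resp. *contractive*) along a pair $\{u,v\}$ if $\langle p_u-p_v,\,m_u-m_v\rangle>0$ (resp. $<0$). For two pairs $\{a,b\}$, $\{c,d\}$, the framework is *expansive-contractive* if every infinitesimal motion that is expansive (resp. contractive) along one of the pairs is contractive (resp. expansive) along the other, and *expansive-expansive* if every infinitesimal motion that is expansive (resp. contractive) along one of the pairs is expansive (resp. contractive) along the other. **Theorem 3.1.** Let $n\ge 7$ and let $G_1,\dots,G_n$ be graphs, each with two specified *hinge non-edges* $\{a_i,b_i\}$ and $\{c_i,d_i\}$. Let $\Gamma$ be the ring graph obtained by gluing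 $G_1,\dots,G_n$ cyclically along hinge non-edges: for each $i$ (indices modulo $n$), $c_i$ is identified with $a_{i+1}$ and $d_i$ with $b_{i+1}$; $G_i$ and $G_{i+1}$ share exactly these two vertices, non-neighbouring $G_i$, $G_j$ share no vertex, and $\Gamma$ is the union of the $G_i$. Suppose that 1. each $G_i$ is nucleation-free; and 2. one of the $G_i$ has a generic expansive-contractive realization, and each of the remaining ones has a generic expansive-expansive realization, with respect to the pairs $\{a_i,b_i\}$, $\{c_i,d_i\}$, where a realization of $G_i$ is called generic if it is generic for $G_i$ with these two pairs added as edges. Then $\Gamma$ is nucleation-free, and all its hinge non-edges $\{c_i,d_i\}$ are implied non-edges of $\Gamma$. -/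

import Mathlib

open Topology

namespace Rigidity3D

/-- Points of Euclidean 3-space. -/
abbrev E3 : Type := EuclideanSpace ℝ (Fin 3)

open Classical in
/-- The row of the 3D rigidity matrix that belongs to the pair `{u, v}`, at the placement `p`.
Its columns are the coordinates of the vertices: `p u - p v` in the three columns of `u`,
`p v - p u` in the three columns of `v`, and `0` elsewhere.  It is symmetric in `u` and `v`. -/
noncomputable def rigidityRow {V : Type*} (p : V → E3) (u v : V) : V × Fin 3 → ℝ := fun x =>
  (if x.1 = u then p u x.2 - p v x.2 else 0) + (if x.1 = v then p v x.2 - p u x.2 else 0)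

/-- The row space of the rigidity matrix of the framework `(G, p)`. -/
def rowSpace {V : Type*} (G : SimpleGraph V) (p : V → E3) : Submodule ℝ (V × Fin 3 → ℝ) :=
  Submodule.span ℝ {r | ∃ u v, G.Adj u v ∧ r = rigidityRow p u v}

/-- The rank of the rigidity matrix of the framework `(G, p)`. -/
noncomputable def rigidityRank {V : Type*} (G : SimpleGraph V) (p : V → E3) : ℕ :=
  Module.finrank ℝ (rowSpace G p)

/-- A framework is generic if its rigidity matrix has maximum rank over all frameworks of the
same graph. -/
def IsGeneric {V : Type*} (G : SimpleGraph V) (p : V → E3) : Prop :=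
  ∀ q : V → E3, rigidityRank G q ≤ rigidityRank G p

/-- A framework `(G, p)` is rigid if every framework of `G` close enough to it with the same edge
lengths is congruent to it. -/
def IsRigidFramework {V : Type*} (G : SimpleGraph V) (p : V → E3) : Prop :=
  ∀ᶠ q in 𝓝 p, (∀ u v, G.Adj u v → dist (q u) (q v) = dist (p u) (p v)) → Congruent q p

/-- A graph is rigid if it has a generic framework that is rigid. -/
def IsRigid {V : Type*} (G : SimpleGraph V) : Prop :=
  ∃ p : V → E3, IsGeneric G p ∧ IsRigidFramework G p

/-- A (finite) graph is nucleation-free if no subgraph with at least five vertices is rigid as a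
graph of its own. -/
def NucleationFree {V : Type*} (G : SimpleGraph V) : Prop :=
  ∀ H : G.Subgraph, 5 ≤ H.verts.ncard → ¬ IsRigid H.coe

/-- The non-edge `{u, v}` is implied by `G` if its row depends linearly on the rows of the generic
rigidity matrix of `G`. -/
def IsImpliedNonEdge {V : Type*} (G : SimpleGraph V) (u v : V) : Prop :=
  u ≠ v ∧ ¬ G.Adj u v ∧ ∀ p : V → E3, IsGeneric G p → rigidityRow p u v ∈ rowSpace G p

/-- Infinitesimal motions of the framework `(G, p)`. -/
def IsInfinitesimalMotion {V : Type*} (G : SimpleGraph V) (p m : V → E3) : Prop :=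
  ∀ u v, G.Adj u v → inner ℝ (p u - p v) (m u - m v) = 0

/-- The rate of change of (half the squared) distance of `u` and `v` under the velocities `m`:
`m` is expansive along `{u, v}` if it is positive, and contractive if it is negative. -/
noncomputable def stretch {V : Type*} (p m : V → E3) (u v : V) : ℝ :=
  inner ℝ (p u - p v) (m u - m v)

/-- The framework `(G, p)` is expansive-contractive for the pairs `{a, b}` and `{c, d}`: an
infinitesimal motion that is expansive along one of them is contractive along the other. -/
def IsExpansiveContractive {V : Type*} (G : SimpleGraph V) (a b c d : V) (p : V → E3) : Prop :=
  ∀ m : V → E3, IsInfinitesimalMotion G p m →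
    (0 < stretch p m a b ↔ stretch p m c d < 0) ∧ (stretch p m a b < 0 ↔ 0 < stretch p m c d)

/-- The framework `(G, p)` is expansive-expansive for the pairs `{a, b}` and `{c, d}`: an
infinitesimal motion is expansive along one of them iff it is along the other, and likewise for
contractive. -/
def IsExpansiveExpansive {V : Type*} (G : SimpleGraph V) (a b c d : V) (p : V → E3) : Prop :=
  ∀ m : V → E3, IsInfinitesimalMotion G p m →
    (0 < stretch p m a b ↔ 0 < stretch p m c d) ∧ (stretch p m a b < 0 ↔ stretch p m c d < 0)

/-- The graph `G` with the pairs `{a, b}` and `{c, d}` added as edges. -/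
def addHinges {V : Type*} (G : SimpleGraph V) (a b c d : V) : SimpleGraph V :=
  G ⊔ SimpleGraph.edge a b ⊔ SimpleGraph.edge c d

/-- `G` has a generic realization that is expansive-contractive for the hinges `{a, b}`, `{c, d}`.
Genericity refers to `G` together with its two hinges. -/
def HasExpansiveContractive {V : Type*} (G : SimpleGraph V) (a b c d : V) : Prop :=
  ∃ p : V → E3, IsGeneric (addHinges G a b c d) p ∧ IsExpansiveContractive G a b c d p

/-- `G` has a generic realization that is expansive-expansive for the hinges `{a, b}`, `{c, d}`.
Genericity refers to `G` together with its two hinges. -/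
def HasExpansiveExpansive {V : Type*} (G : SimpleGraph V) (a b c d : V) : Prop :=
  ∃ p : V → E3, IsGeneric (addHinges G a b c d) p ∧ IsExpansiveExpansive G a b c d p

/-- `Γ` is the ring graph obtained by gluing the graphs `G i` cyclically along hinge non-edges.
The maps `φ i` include the vertex sets in that of `Γ`.  `{a i, b i}` is the hinge
of `G i` shared with its predecessor and `{c i, d i}` the one shared with its successor.
Nothing else is identified, and `Γ` has no further vertices or edges. -/
structure IsRing {n : ℕ} [NeZero n] {W : Fin n → Type*} (G : ∀ i, SimpleGraph (W i))
    (a b c d : ∀ i, W i) {V : Type*} (Γ : SimpleGraph V) (φ : ∀ i, W i ↪ V) : Prop where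
  ne_ab : ∀ i, a i ≠ b i
  ne_cd : ∀ i, c i ≠ d i
  not_adj_ab : ∀ i, ¬ (G i).Adj (a i) (b i)
  not_adj_cd : ∀ i, ¬ (G i).Adj (c i) (d i)
  glue_ca : ∀ i, φ i (c i) = φ (i + 1) (a (i + 1))
  glue_db : ∀ i, φ i (d i) = φ (i + 1) (b (i + 1))
  /-- Neighbours share the two vertices of their hinge and nothing else. -/
  inter : ∀ i, Set.range (φ i) ∩ Set.range (φ (i + 1)) = {φ i (c i), φ i (d i)}
  /-- Graphs that are not neighbours share no vertex. -/
  disjoint : ∀ i j, i ≠ j → j ≠ i + 1 → i ≠ j + 1 →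
    Disjoint (Set.range (φ i)) (Set.range (φ j))
  cover : ∀ x : V, ∃ i, x ∈ Set.range (φ i)
  graph_eq : Γ = ⨆ i, (G i).map (φ i)

end Rigidity3D

open Rigidity3D

/-! Implied hinges. By duality a hinge row lies in the row space iff every infinitesimal motion has
zero stretch along the hinge. The expansive conditions force the two hinge stretches of a member to
vanish together, so on motions they are proportional with a nonzero ratio. This persists on the open
dense set of hinge-generic placements, and there the sign of the ratio is locally constant
(`isOpen_hingeGeneric_hasSign`). If some hinge were not implied, densely many placements of the ring
would have a motion stretching that hinge, hence all hinges; multiplying the ratios once around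
gives 1, so the signs have product 1.

The given realizations have signs of product -1, but they need not fit together in a ring, and
hinge-generic placements may form several components. The remedy is that, under the assumption to be
refuted, the sign of each member is constant. View it as a function of the hinge positions `x`, `y`.
Completing four placements by the same rest of the ring shows that the signs around a rectangle
multiply to 1 (`IsRing.signAt_exchange`). Invariance under a similarity `k` then makes the sign
unchanged when `k ∘ k` is applied to `x` alone. Squares of similarities connect any two pairs of
distinct points, so the sign depends on neither `x` nor `y` (`IsSignRelation.const`). This
contradicts the product -1 (`IsRing.rigidityRow_mem`).

Nucleation-freeness. A rigid graph on at least five vertices has at most a six-dimensional space of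
motions at a generic placement (`IsRigid.finrank_motions_le`). A subgraph of the ring meeting every
hinge has at least `n ≥ 7` degrees of freedom (`IsRing.le_finrank_motions`). One missing a hinge
lives on a chain of members; rotations about the other hinges confine it to one member if it is
rigid (`IsRing.subset_range_of_missing_hinge`), and the members are nucleation-free. -/

namespace Rigidity3D

open Module

/-! ### Motions as the annihilator of the rigidity rows. -/

/-- `stretch` as a linear functional of the velocities. -/
noncomputable def stretchₗ {V : Type*} (p : V → E3) (u v : V) : (V → E3) →ₗ[ℝ] ℝ :=
  (innerₛₗ ℝ (p u - p v)).comp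
    ((LinearMap.proj u : (V → E3) →ₗ[ℝ] E3) - (LinearMap.proj v : (V → E3) →ₗ[ℝ] E3))

@[simp] lemma stretchₗ_apply {V : Type*} (p m : V → E3) (u v : V) :
    stretchₗ p u v m = stretch p m u v := by
  simp [stretchₗ, stretch, inner_sub_left]

lemma stretch_comm {V : Type*} (p m : V → E3) (u v : V) : stretch p m u v = stretch p m v u := by
  unfold stretch
  rw [← neg_sub (p v), ← neg_sub (m v), inner_neg_neg]

/-- The space of infinitesimal motions of `(G, p)`. -/
noncomputable def motions {V : Type*} (G : SimpleGraph V) (p : V → E3) : Submodule ℝ (V → E3) where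
  carrier := {m | IsInfinitesimalMotion G p m}
  add_mem' := by
    intro m m' h h' u v huv
    have h1 : stretchₗ p u v m = 0 := by rw [stretchₗ_apply]; exact h u v huv
    have h2 : stretchₗ p u v m' = 0 := by rw [stretchₗ_apply]; exact h' u v huv
    have := map_add (stretchₗ p u v) m m'
    rw [h1, h2, stretchₗ_apply] at this
    simpa [stretch] using this
  zero_mem' := by intro u v _; simp
  smul_mem' := by
    intro c m h u v huv
    have h1 : stretchₗ p u v m = 0 := by rw [stretchₗ_apply]; exact h u v huv
    have := map_smul (stretchₗ p u v) c m
    rw [h1, stretchₗ_apply] at this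
    simpa [stretch] using this

lemma mem_motions {V : Type*} {G : SimpleGraph V} {p m : V → E3} :
    m ∈ motions G p ↔ ∀ u v, G.Adj u v → stretch p m u v = 0 := Iff.rfl

lemma motions_anti {V : Type*} {G G' : SimpleGraph V} (h : G ≤ G') (p : V → E3) :
    motions G' p ≤ motions G p := fun _ hm u v huv => hm u v (h huv)

section
variable {V : Type*} [Fintype V]

open Classical in
/-- Velocities as functionals on the space of rows. -/
noncomputable def velocityDual : (V → E3) ≃ₗ[ℝ] Dual ℝ (V × Fin 3 → ℝ) :=
  ((LinearEquiv.piCongrRight fun _ : V => WithLp.linearEquiv 2 ℝ (Fin 3 → ℝ)).trans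
    (LinearEquiv.curry ℝ ℝ V (Fin 3)).symm).trans (Pi.basisFun ℝ (V × Fin 3)).toDualEquiv

lemma velocityDual_apply (m : V → E3) (r : V × Fin 3 → ℝ) :
    velocityDual m r = ∑ x : V × Fin 3, r x * m x.1 x.2 := by
  classical
  simp only [velocityDual, LinearEquiv.trans_apply, Basis.toDualEquiv_apply]
  conv_lhs => rw [← (Pi.basisFun ℝ (V × Fin 3)).sum_repr r, map_sum]
  refine Finset.sum_congr rfl fun x _ => ?_
  rw [map_smul, Basis.toDual_apply_left]
  simp [LinearEquiv.curry, Function.uncurry]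

lemma velocityDual_rigidityRow (p m : V → E3) (u v : V) :
    velocityDual m (rigidityRow p u v) = stretch p m u v := by
  classical
  rw [velocityDual_apply, Fintype.sum_prod_type]
  simp only [rigidityRow, stretch, add_mul, Finset.sum_add_distrib, ite_mul, zero_mul]
  simp only [PiLp.inner_apply]
  rw [Finset.sum_comm, Finset.sum_comm (f := fun x y => if x = v then _ else _)]
  simp only [Finset.sum_ite_eq', Finset.mem_univ, if_true, ← Finset.sum_add_distrib]
  refine Finset.sum_congr rfl fun k _ => ?_
  simp
  ring

lemma mem_motions_iff_dualAnnihilator {G : SimpleGraph V} {p m : V → E3} :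
    m ∈ motions G p ↔ velocityDual m ∈ (rowSpace G p).dualAnnihilator := by
  rw [rowSpace, Submodule.mem_dualAnnihilator, mem_motions]
  constructor
  · intro h w hw
    induction hw using Submodule.span_induction with
    | mem x hx => obtain ⟨u, v, huv, rfl⟩ := hx; rw [velocityDual_rigidityRow]; exact h u v huv
    | zero => simp
    | add x y _ _ hx hy => simp [hx, hy]
    | smul c x _ hx => simp [hx]
  · intro h u v huv
    rw [← velocityDual_rigidityRow]
    exact h _ (Submodule.subset_span ⟨u, v, huv, rfl⟩)

/-- Finite-dimensional double annihilation. It reduces impliedness and proportionality of rows to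
statements about stretches on motions. -/
lemma mem_rowSpace_iff {G : SimpleGraph V} {p : V → E3} {r : V × Fin 3 → ℝ} :
    r ∈ rowSpace G p ↔ ∀ m ∈ motions G p, velocityDual m r = 0 := by
  rw [← Subspace.forall_mem_dualAnnihilator_apply_eq_zero_iff]
  constructor
  · intro h m hm
    exact h _ (mem_motions_iff_dualAnnihilator.1 hm)
  · intro h φ hφ
    obtain ⟨m, rfl⟩ := velocityDual.surjective φ
    exact h m (mem_motions_iff_dualAnnihilator.2 hφ)

lemma rigidityRank_add_finrank_motions (G : SimpleGraph V) (p : V → E3) :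
    rigidityRank G p + finrank ℝ (motions G p) = 3 * Fintype.card V := by
  have h := Subspace.finrank_add_finrank_dualAnnihilator_eq (rowSpace G p)
  have h2 : motions G p = (rowSpace G p).dualAnnihilator.comap velocityDual.toLinearMap := by
    ext m; exact mem_motions_iff_dualAnnihilator
  have h3 : finrank ℝ (motions G p) = finrank ℝ (rowSpace G p).dualAnnihilator := by
    have h4 : motions G p = (rowSpace G p).dualAnnihilator.map
        (velocityDual (V := V)).symm.toLinearMap := by
      rw [h2]
      exact Submodule.comap_equiv_eq_map_symm velocityDual _
    rw [h4]
    exact LinearEquiv.finrank_map_eq velocityDual.symm _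
  rw [rigidityRank, h3, h, finrank_fintype_fun_eq_card]
  simp [mul_comm]

end

lemma rigidityRow_symm {V : Type*} (p : V → E3) (u v : V) :
    rigidityRow p u v = rigidityRow p v u := by
  ext x; simp [rigidityRow, add_comm]

lemma rowSpace_sup_edge {V : Type*} (G : SimpleGraph V) (p : V → E3) {u v : V} (huv : u ≠ v) :
    rowSpace (G ⊔ SimpleGraph.edge u v) p = rowSpace G p ⊔ ℝ ∙ rigidityRow p u v := by
  rw [rowSpace, rowSpace, ← Submodule.span_union]
  congr 1
  ext r
  simp only [Set.mem_ofPred_eq, SimpleGraph.sup_adj, SimpleGraph.edge_adj, Set.mem_union,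
    Set.mem_singleton_iff]
  constructor
  · rintro ⟨x, y, h | ⟨⟨rfl, rfl⟩ | ⟨rfl, rfl⟩, -⟩, rfl⟩
    · exact Or.inl ⟨x, y, h, rfl⟩
    · exact Or.inr rfl
    · exact Or.inr (rigidityRow_symm ..)
  · rintro (⟨x, y, h, rfl⟩ | rfl)
    · exact ⟨x, y, Or.inl h, rfl⟩
    · exact ⟨u, v, Or.inr ⟨Or.inl ⟨rfl, rfl⟩, huv⟩, rfl⟩

/-! ### Density and openness of rank conditions -/

/-- By the identity theorem, vanishing near one point would propagate to the whole connected space.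
-/
lemma dense_ne_zero_of_analytic {E : Type*} [NormedAddCommGroup E] [NormedSpace ℝ E] {f : E → ℝ}
    (hf : AnalyticOnNhd ℝ f Set.univ) {e₀ : E} (h₀ : f e₀ ≠ 0) : Dense {e | f e ≠ 0} := by
  intro e
  rw [mem_closure_iff_frequently]
  by_contra hcon
  rw [Filter.not_frequently] at hcon
  have hev : f =ᶠ[𝓝 e] (fun _ => (0 : ℝ)) := by
    filter_upwards [hcon] with x hx
    simpa using hx
  exact h₀ (hf.eqOn_of_preconnected_of_eventuallyEq analyticOnNhd_const isPreconnected_univ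
    (Set.mem_univ e) hev (Set.mem_univ e₀))

/-- A rank bound from below is witnessed by a non-vanishing minor. -/
lemma exists_minor {ι κ : Type*} [Fintype ι] [Fintype κ] {k : ℕ} {w₀ : ι → κ → ℝ}
    (h : k ≤ finrank ℝ (Submodule.span ℝ (Set.range w₀))) :
    ∃ D : (ι → κ → ℝ) → ℝ, AnalyticOnNhd ℝ D Set.univ ∧ D w₀ ≠ 0 ∧
      ∀ w, D w ≠ 0 → k ≤ finrank ℝ (Submodule.span ℝ (Set.range w)) := by
  classical
  obtain ⟨f, hf, -, hli⟩ := Submodule.exists_fun_fin_finrank_span_eq ℝ (Set.range w₀)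
  choose g hg using hf
  generalize finrank ℝ (Submodule.span ℝ (Set.range w₀)) = r at h f hli g hg
  -- `L` reads off coordinates in the basis `f` picked from the rows of `w₀`, so the minor built
  -- from it is the determinant of the identity at `w₀`.
  obtain ⟨L, hL⟩ := LinearMap.exists_leftInverse_of_injective
    (Fintype.linearCombination ℝ f) (by
      rw [LinearMap.ker_eq_bot]
      exact hli.fintypeLinearCombination_injective)
  have hL' : ∀ i, L (f i) = Pi.single i 1 := by
    intro i
    have := LinearMap.congr_fun hL (Pi.single i 1)
    simpa [Fintype.linearCombination_apply, Pi.single_apply] using this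
  let M : (ι → κ → ℝ) → Matrix (Fin r) (Fin r) ℝ := fun w => Matrix.of fun i j => L (w (g i)) j
  refine ⟨fun w => (M w).det, ?_, ?_, ?_⟩
  · intro w _
    have hentry : ∀ i j, AnalyticAt ℝ (fun w => M w i j) w := by
      intro i j
      let ℓ : (ι → κ → ℝ) →ₗ[ℝ] ℝ := (LinearMap.proj j).comp (L.comp (LinearMap.proj (g i)))
      exact ℓ.toContinuousLinearMap.analyticAt w
    simp only [Matrix.det_apply]
    refine Finset.analyticAt_fun_sum _ fun σ _ => ?_
    simp only [Units.smul_def, zsmul_eq_mul]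
    exact analyticAt_const.mul (Finset.analyticAt_fun_prod _ fun i _ => hentry _ _)
  · have : M w₀ = 1 := by
      ext i j
      simp only [M, Matrix.of_apply, Matrix.one_apply]
      rw [hg, hL', Pi.single_apply]
      simp only [eq_comm]
    simp [this]
  · intro w hw
    have hli' : LinearIndependent ℝ (fun i => L (w (g i))) := by
      have := Matrix.linearIndependent_rows_of_det_ne_zero hw
      exact this
    have hli2 : LinearIndependent ℝ (fun i => w (g i)) := LinearIndependent.of_comp L hli'
    calc k ≤ r := h
      _ = finrank ℝ (Submodule.span ℝ (Set.range fun i => w (g i))) := by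
          rw [finrank_span_eq_card hli2, Fintype.card_fin]
      _ ≤ _ := Submodule.finrank_mono (Submodule.span_mono (by
          rintro _ ⟨i, rfl⟩; exact ⟨g i, rfl⟩))

lemma isOpen_le_finrank_span {ι κ X : Type*} [Finite ι] [Finite κ] [TopologicalSpace X]
    {w : X → ι → κ → ℝ} (hw : Continuous w) (k : ℕ) :
    IsOpen {x | k ≤ finrank ℝ (Submodule.span ℝ (Set.range (w x)))} := by
  have := Fintype.ofFinite ι
  have := Fintype.ofFinite κ
  rw [isOpen_iff_mem_nhds]
  intro x hx
  obtain ⟨D, hD, h0, hD'⟩ := exists_minor hx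
  have hc : Continuous fun x => D (w x) :=
    (continuousOn_univ.1 hD.continuousOn).comp hw
  filter_upwards [hc.continuousAt.eventually_ne h0] with y hy
  exact hD' _ hy

/-- The rows of the edges of `G`, as a family. -/
noncomputable def rowFamily {V : Type*} (G : SimpleGraph V) (p : V → E3) :
    {e : V × V // G.Adj e.1 e.2} → V × Fin 3 → ℝ :=
  fun e => rigidityRow p e.1.1 e.1.2

lemma rowSpace_eq_span_rowFamily {V : Type*} (G : SimpleGraph V) (p : V → E3) :
    rowSpace G p = Submodule.span ℝ (Set.range (rowFamily G p)) := by
  rw [rowSpace]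
  congr 1
  ext r
  constructor
  · rintro ⟨u, v, h, rfl⟩; exact ⟨⟨(u, v), h⟩, rfl⟩
  · rintro ⟨⟨⟨u, v⟩, h⟩, rfl⟩; exact ⟨u, v, h, rfl⟩

lemma rigidityRank_eq {V : Type*} (G : SimpleGraph V) (p : V → E3) :
    rigidityRank G p = finrank ℝ (Submodule.span ℝ (Set.range (rowFamily G p))) := by
  rw [rigidityRank, rowSpace_eq_span_rowFamily]

lemma continuous_rigidityRow {V : Type*} (u v : V) :
    Continuous fun p : V → E3 => rigidityRow p u v := by
  refine continuous_pi fun x => ?_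
  unfold rigidityRow
  split_ifs <;> fun_prop

lemma analyticAt_rigidityRow {V E : Type*} [Fintype V] [NormedAddCommGroup E] [NormedSpace ℝ E]
    {g : E → V → E3} {e : E} (hg : ∀ u, AnalyticAt ℝ (fun e => g e u) e) (u v : V) :
    AnalyticAt ℝ (fun e => rigidityRow (g e) u v) e := by
  rw [analyticAt_pi_iff]
  intro x
  have hc : ∀ w, AnalyticAt ℝ (fun e => g e w x.2) e := fun w =>
    ((EuclideanSpace.proj x.2 : E3 →L[ℝ] ℝ).analyticAt _).comp (hg w)
  unfold rigidityRow
  split_ifs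
  · exact ((hc u).sub (hc v)).add ((hc v).sub (hc u))
  · exact ((hc u).sub (hc v)).add analyticAt_const
  · exact analyticAt_const.add ((hc v).sub (hc u))
  · exact analyticAt_const.add analyticAt_const

lemma isOpen_le_rigidityRank {V : Type*} [Finite V] (G : SimpleGraph V) (k : ℕ) :
    IsOpen {p | k ≤ rigidityRank G p} := by
  simp only [rigidityRank_eq]
  exact isOpen_le_finrank_span (continuous_pi fun e => continuous_rigidityRow _ _) k

/-- A non-vanishing minor stays analytic along `g`. The parametrization is there for families in
which two vertices are pinned to prescribed positions. -/
lemma dense_le_rigidityRank {V E : Type*} [Finite V] [NormedAddCommGroup E] [NormedSpace ℝ E]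
    (G : SimpleGraph V) {k : ℕ} {g : E → V → E3} (hg : ∀ u e, AnalyticAt ℝ (fun e => g e u) e)
    (h : ∃ e, k ≤ rigidityRank G (g e)) : Dense {e | k ≤ rigidityRank G (g e)} := by
  classical
  have := Fintype.ofFinite V
  have := Fintype.ofFinite {e : V × V // G.Adj e.1 e.2}
  obtain ⟨e₀, h₀⟩ := h
  simp only [rigidityRank_eq] at h₀ ⊢
  obtain ⟨D, hD, h1, hD'⟩ := exists_minor h₀
  refine (dense_ne_zero_of_analytic (f := fun e => D (rowFamily G (g e))) ?_ h1).mono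
    fun e he => hD' _ he
  intro e _
  refine (hD _ (Set.mem_univ _)).fun_comp ?_
  rw [analyticAt_pi_iff]
  exact fun x => analyticAt_rigidityRow (fun u => hg u e) _ _

/-! ### Hinges, the ratio of their stretches, and its sign. -/

lemma mem_motions_sup_edge {V : Type*} {G : SimpleGraph V} {p m : V → E3} {u v : V} :
    m ∈ motions (G ⊔ SimpleGraph.edge u v) p ↔ m ∈ motions G p ∧ stretch p m u v = 0 := by
  simp only [mem_motions, SimpleGraph.sup_adj, SimpleGraph.edge_adj]
  constructor
  · intro h
    refine ⟨fun x y hxy => h x y (Or.inl hxy), ?_⟩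
    by_cases huv : u = v
    · simp [stretch, huv]
    · exact h u v (Or.inr ⟨Or.inl ⟨rfl, rfl⟩, huv⟩)
  · rintro ⟨h, h0⟩ x y (hxy | ⟨⟨rfl, rfl⟩ | ⟨rfl, rfl⟩, -⟩)
    · exact h x y hxy
    · exact h0
    · rw [stretch_comm]; exact h0

lemma mem_motions_addHinges {V : Type*} {G : SimpleGraph V} {p m : V → E3} {a b c d : V} :
    m ∈ motions (addHinges G a b c d) p ↔
      m ∈ motions G p ∧ stretch p m a b = 0 ∧ stretch p m c d = 0 := by
  rw [addHinges, mem_motions_sup_edge, mem_motions_sup_edge, and_assoc]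

lemma motions_eq_of_rank_le {V : Type*} [Finite V] {G G' : SimpleGraph V} (h : G ≤ G') {p : V → E3}
    (hr : rigidityRank G' p ≤ rigidityRank G p) : motions G' p = motions G p := by
  have := Fintype.ofFinite V
  refine Submodule.eq_of_le_of_finrank_le (motions_anti h p) ?_
  have h1 := rigidityRank_add_finrank_motions G p
  have h2 := rigidityRank_add_finrank_motions G' p
  omega

lemma rank_eq_of_motions_eq {V : Type*} [Finite V] {G G' : SimpleGraph V} {p : V → E3}
    (h : motions G' p = motions G p) : rigidityRank G' p = rigidityRank G p := by
  have := Fintype.ofFinite V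
  have h1 := rigidityRank_add_finrank_motions G p
  have h2 := rigidityRank_add_finrank_motions G' p
  rw [h] at h2
  omega

/-- At `p`, each of the hinges alone raises the rank of `G` to at least `M`. -/
def HingeGeneric {W : Type*} (G : SimpleGraph W) (a b c d : W) (M : ℕ) (p : W → E3) : Prop :=
  M ≤ rigidityRank (G ⊔ SimpleGraph.edge a b) p ∧ M ≤ rigidityRank (G ⊔ SimpleGraph.edge c d) p

/-- The stretches of the two hinges are proportional on all motions, with a factor of sign `ε`. -/
def HasSign {W : Type*} (G : SimpleGraph W) (a b c d : W) (ε : ℤˣ) (p : W → E3) : Prop :=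
  ∃ l : ℝ, 0 < ((ε : ℤ) : ℝ) * l ∧ ∀ m ∈ motions G p, stretch p m a b = l * stretch p m c d

/-- The vector `g m₀ • m - g m • m₀` is killed by `g`, hence by `f`, which gives the ratio `f m₀ / g
m₀`. -/
lemma exists_ratio {E : Type*} [AddCommGroup E] [Module ℝ E] (S : Submodule ℝ E)
    (f g : E →ₗ[ℝ] ℝ) (h : ∀ m ∈ S, f m = 0 ↔ g m = 0) :
    ∃ l : ℝ, l ≠ 0 ∧ ∀ m ∈ S, f m = l * g m := by
  by_cases hg : ∀ m ∈ S, g m = 0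
  · exact ⟨1, one_ne_zero, fun m hm => by rw [hg m hm, (h m hm).2 (hg m hm), mul_zero]⟩
  push Not at hg
  obtain ⟨m₀, hm₀, hg₀⟩ := hg
  refine ⟨f m₀ / g m₀, div_ne_zero (fun hf => hg₀ ((h m₀ hm₀).1 hf)) hg₀, fun m hm => ?_⟩
  have hmem : g m₀ • m - g m • m₀ ∈ S := S.sub_mem (S.smul_mem _ hm) (S.smul_mem _ hm₀)
  have h0 : f (g m₀ • m - g m • m₀) = 0 := (h _ hmem).2 (by simp [mul_comm])
  simp only [map_sub, map_smul, smul_eq_mul] at h0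
  field_simp
  linarith

lemma units_sign_exists {l : ℝ} (hl : l ≠ 0) : ∃ ε : ℤˣ, 0 < ((ε : ℤ) : ℝ) * l := by
  rcases lt_or_gt_of_ne hl with h | h
  · exact ⟨-1, by simpa using h⟩
  · exact ⟨1, by simpa using h⟩

section
variable {W : Type*} [Finite W] {G : SimpleGraph W} {a b c d : W} {M : ℕ} {p : W → E3}

/-- Either hinge alone already reaches the largest rank possible with both, so it cuts out the same
motions as both together. -/
lemma HingeGeneric.stretch_eq_zero_iff (hM : ∀ q, rigidityRank (addHinges G a b c d) q ≤ M)
    (hp : HingeGeneric G a b c d M p) {m : W → E3} (hm : m ∈ motions G p) :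
    stretch p m a b = 0 ↔ stretch p m c d = 0 := by
  have h1 : motions (addHinges G a b c d) p = motions (G ⊔ SimpleGraph.edge a b) p :=
    motions_eq_of_rank_le le_sup_left ((hM p).trans hp.1)
  have h2 : motions (addHinges G a b c d) p = motions (G ⊔ SimpleGraph.edge c d) p :=
    motions_eq_of_rank_le (sup_le_sup_right le_sup_left _) ((hM p).trans hp.2)
  constructor
  · intro h
    have := mem_motions_sup_edge.2 ⟨hm, h⟩
    rw [← h1, mem_motions_addHinges] at this
    exact this.2.2
  · intro h
    have := mem_motions_sup_edge.2 ⟨hm, h⟩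
    rw [← h2, mem_motions_addHinges] at this
    exact this.2.1

lemma HingeGeneric.exists_sign (hM : ∀ q, rigidityRank (addHinges G a b c d) q ≤ M)
    (hp : HingeGeneric G a b c d M p) : ∃ ε, HasSign G a b c d ε p := by
  obtain ⟨l, hl, h⟩ := exists_ratio (motions G p) (stretchₗ p a b) (stretchₗ p c d) fun m hm => by
    simpa using hp.stretch_eq_zero_iff hM hm
  obtain ⟨ε, hε⟩ := units_sign_exists hl
  exact ⟨ε, l, hε, by simpa using h⟩

lemma hingeGeneric_of_stretch_eq_zero_iff
    (h : ∀ m ∈ motions G p, stretch p m a b = 0 ↔ stretch p m c d = 0) :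
    HingeGeneric G a b c d (rigidityRank (addHinges G a b c d) p) p := by
  refine ⟨(rank_eq_of_motions_eq ?_).le, (rank_eq_of_motions_eq ?_).le⟩
  · ext m
    rw [mem_motions_addHinges, mem_motions_sup_edge]
    exact ⟨fun h' => ⟨h'.1, h'.2.1⟩, fun h' => ⟨h'.1, h'.2, (h m h'.1).1 h'.2⟩⟩
  · ext m
    rw [mem_motions_addHinges, mem_motions_sup_edge]
    exact ⟨fun h' => ⟨h'.1, h'.2.2⟩, fun h' => ⟨h'.1, (h m h'.1).2 h'.2, h'.2⟩⟩

omit [Finite W] in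
-- Treats both expansive conditions at once, `ε = 1` and `ε = -1`. A single motion with nonzero
-- stretch determines the sign of the ratio.
lemma hasSign_of_pos_iff {ε : ℤˣ}
    (h : ∀ m ∈ motions G p, (0 < stretch p m a b ↔ 0 < ((ε : ℤ) : ℝ) * stretch p m c d) ∧
      (stretch p m a b < 0 ↔ ((ε : ℤ) : ℝ) * stretch p m c d < 0)) :
    (∀ m ∈ motions G p, stretch p m a b = 0 ↔ stretch p m c d = 0) ∧ HasSign G a b c d ε p := by
  have hε : ((ε : ℤ) : ℝ) ≠ 0 := by exact_mod_cast ε.ne_zero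
  have h0 : ∀ m ∈ motions G p, stretch p m a b = 0 ↔ stretch p m c d = 0 := by
    intro m hm
    obtain ⟨h1, h2⟩ := h m hm
    constructor
    · intro h'
      rw [h'] at h1 h2
      have : ((ε : ℤ) : ℝ) * stretch p m c d = 0 := by
        apply le_antisymm
        · exact not_lt.1 fun h => lt_irrefl _ (h1.2 h)
        · exact not_lt.1 fun h => lt_irrefl _ (h2.2 h)
      exact (mul_eq_zero.1 this).resolve_left hε
    · intro h'
      rw [h', mul_zero] at h1 h2
      apply le_antisymm
      · exact not_lt.1 fun h => lt_irrefl _ (h1.1 h)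
      · exact not_lt.1 fun h => lt_irrefl _ (h2.1 h)
  refine ⟨h0, ?_⟩
  obtain ⟨l, hl, hr⟩ := exists_ratio (motions G p) (stretchₗ p a b) (stretchₗ p c d) fun m hm => by
    simpa using h0 m hm
  simp only [stretchₗ_apply] at hr
  by_cases hall : ∀ m ∈ motions G p, stretch p m c d = 0
  -- No motion stretches a hinge here, so any factor of the right sign serves.
  · refine ⟨((ε : ℤ) : ℝ), mul_self_pos.2 hε, fun m hm => ?_⟩
    rw [hall m hm, (h0 m hm).2 (hall m hm), mul_zero]
  push Not at hall
  obtain ⟨m, hm, hne⟩ := hall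
  refine ⟨l, ?_, hr⟩
  have h1 := (h m hm).1
  have h2 := (h m hm).2
  rw [hr m hm] at h1 h2
  have hpos : 0 < (l * stretch p m c d) * (((ε : ℤ) : ℝ) * stretch p m c d) := by
    rcases lt_or_gt_of_ne (mul_ne_zero hl hne) with h' | h'
    · exact mul_pos_of_neg_of_neg h' (h2.1 h')
    · exact mul_pos h' (h1.1 h')
  have hsq : 0 < stretch p m c d ^ 2 := by positivity
  have : (l * stretch p m c d) * (((ε : ℤ) : ℝ) * stretch p m c d)
      = (((ε : ℤ) : ℝ) * l) * stretch p m c d ^ 2 := by ring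
  rw [this] at hpos
  exact pos_of_mul_pos_left hpos hsq.le

/-- `HasSign` in terms of the row space. -/
lemma hasSign_iff_row {ε : ℤˣ} :
    HasSign G a b c d ε p ↔ ∃ l : ℝ, 0 < ((ε : ℤ) : ℝ) * l ∧
      rigidityRow p a b - l • rigidityRow p c d ∈ rowSpace G p := by
  have := Fintype.ofFinite W
  refine exists_congr fun l => and_congr_right fun _ => ?_
  rw [mem_rowSpace_iff]
  refine forall₂_congr fun m hm => ?_
  rw [map_sub, map_smul, velocityDual_rigidityRow, velocityDual_rigidityRow, sub_eq_zero,
    smul_eq_mul]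

/-- A row interpolating between those of the two hinges (up to sign). -/
noncomputable def mixedRow (a b c d : W) (ε : ℤˣ) (t : ℝ) (p : W → E3) : W × Fin 3 → ℝ :=
  (1 - t) • rigidityRow p a b + (((ε : ℤ) : ℝ) * t) • rigidityRow p c d

lemma isOpen_le_mixedRank (G : SimpleGraph W) (a b c d : W) (ε : ℤˣ) (M : ℕ) :
    IsOpen {x : ℝ × (W → E3) |
      M ≤ finrank ℝ ↥(rowSpace G x.2 ⊔ ℝ ∙ mixedRow a b c d ε x.1 x.2)} := by
  let w : ℝ × (W → E3) → Option {e : W × W // G.Adj e.1 e.2} → W × Fin 3 → ℝ :=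
    fun x o => o.elim (mixedRow a b c d ε x.1 x.2) (rowFamily G x.2)
  have hw : Continuous w := by
    refine continuous_pi fun o => ?_
    cases o with
    | none =>
      have h1 := (continuous_rigidityRow (V := W) a b).comp (continuous_snd (X := ℝ))
      have h2 := (continuous_rigidityRow (V := W) c d).comp (continuous_snd (X := ℝ))
      exact ((continuous_const.sub continuous_fst).smul h1).add
        ((continuous_const.mul continuous_fst).smul h2)
    | some e => exact (continuous_rigidityRow (V := W) _ _).comp (continuous_snd (X := ℝ))
  have heq : ∀ x, rowSpace G x.2 ⊔ ℝ ∙ mixedRow a b c d ε x.1 x.2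
      = Submodule.span ℝ (Set.range (w x)) := by
    intro x
    rw [rowSpace_eq_span_rowFamily, ← Submodule.span_union]
    refine congrArg _ (Set.ext fun r => ?_)
    simp only [Set.mem_union, Set.mem_range, Set.mem_singleton_iff, Option.exists, w,
      Option.elim_none, Option.elim_some]
    rw [or_comm, eq_comm (a := r)]
  have hset : {x : ℝ × (W → E3) |
      M ≤ finrank ℝ ↥(rowSpace G x.2 ⊔ ℝ ∙ mixedRow a b c d ε x.1 x.2)}
      = {x | M ≤ finrank ℝ (Submodule.span ℝ (Set.range (w x)))} := by
    ext x
    change M ≤ _ ↔ M ≤ _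
    rw [heq]
  rw [hset]
  exact isOpen_le_finrank_span hw M

/-- Modulo the row space the mixed row is `(1 - t) * l + ε * t` times the row of `{c, d}`. On `[0,
1]` this coefficient has no zero exactly when `l` has sign `ε`. The sign thus becomes a family of
lower rank bounds, which are open conditions. -/
lemma HingeGeneric.hasSign_iff_mixedRank (hcd : c ≠ d)
    (hM : ∀ q, rigidityRank (addHinges G a b c d) q ≤ M) (hlt : rigidityRank G p < M)
    (hp : HingeGeneric G a b c d M p) (ε : ℤˣ) : HasSign G a b c d ε p ↔
      ∀ t ∈ Set.Icc (0 : ℝ) 1,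
        M ≤ finrank ℝ ↥(rowSpace G p ⊔ ℝ ∙ mixedRow a b c d ε t p) := by
  have hε : ((ε : ℤ) : ℝ) * ((ε : ℤ) : ℝ) = 1 := by
    rcases Int.units_eq_one_or ε with rfl | rfl <;> simp
  constructor
  · intro hs t ht
    obtain ⟨l, hl, hrow⟩ := hasSign_iff_row.1 hs
    refine hp.2.trans ?_
    rw [rigidityRank, rowSpace_sup_edge G p hcd]
    refine Submodule.finrank_mono (sup_le le_sup_left ?_)
    rw [Submodule.span_singleton_le_iff_mem]
    set s := (1 - t) * l + ((ε : ℤ) : ℝ) * t with hs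
    have hs0 : s ≠ 0 := by
      intro h0
      have h2 : (1 - t) * (((ε : ℤ) : ℝ) * l) + t = 0 := by
        have := congrArg (fun z => ((ε : ℤ) : ℝ) * z) h0
        simp only [hs, mul_zero] at this
        linear_combination this - t * hε
      rcases eq_or_lt_of_le ht.2 with h1 | h1
      · rw [h1] at h2; norm_num at h2
      · have := mul_pos (sub_pos.2 h1) hl
        linarith [ht.1]
    have hmix : mixedRow a b c d ε t p
        = (1 - t) • (rigidityRow p a b - l • rigidityRow p c d) + s • rigidityRow p c d := by
      rw [mixedRow, hs]; module
    have h3 : rigidityRow p c d = s⁻¹ • (mixedRow a b c d ε t p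
        - (1 - t) • (rigidityRow p a b - l • rigidityRow p c d)) := by
      rw [hmix, add_sub_cancel_left, smul_smul, inv_mul_cancel₀ hs0, one_smul]
    rw [h3]
    refine Submodule.smul_mem _ _ (Submodule.sub_mem _ ?_ ?_)
    · exact Submodule.mem_sup_right (Submodule.mem_span_singleton_self _)
    · exact Submodule.mem_sup_left (Submodule.smul_mem _ _ hrow)
  · intro h
    obtain ⟨ε', hs'⟩ := hp.exists_sign hM
    obtain ⟨l, hl, hrow⟩ := hasSign_iff_row.1 hs'
    have hl0 : l ≠ 0 := by rintro rfl; simp at hl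
    have hεl : ((ε : ℤ) : ℝ) * l ≠ 0 := mul_ne_zero (by exact_mod_cast ε.ne_zero) hl0
    rcases lt_or_gt_of_ne hεl with hneg | hpos
    · exfalso
      set s := ((ε : ℤ) : ℝ) * l with hsdef
      have h1s : 0 < 1 - s := by linarith
      -- The zero of `(1 - t) * s + t`, where the mixed row falls into the row space.
      have ht : -s / (1 - s) ∈ Set.Icc (0 : ℝ) 1 :=
        ⟨div_nonneg (by linarith) h1s.le, by rw [div_le_one h1s]; linarith⟩
      have h2 := h _ ht
      have hmem : mixedRow a b c d ε (-s / (1 - s)) p ∈ rowSpace G p := by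
        have : mixedRow a b c d ε (-s / (1 - s)) p
            = (1 - -s / (1 - s)) • (rigidityRow p a b - l • rigidityRow p c d) := by
          have hl' : l = ((ε : ℤ) : ℝ) * s := by rw [hsdef, ← mul_assoc, hε, one_mul]
          have h4 : ((ε : ℤ) : ℝ) * (-s / (1 - s)) = - ((1 - -s / (1 - s)) * l) := by
            rw [hl']; field_simp; ring
          rw [mixedRow, h4]; module
        rw [this]
        exact Submodule.smul_mem _ _ hrow
      rw [sup_eq_left.2 ((Submodule.span_singleton_le_iff_mem _ _).2 hmem)] at h2
      exact absurd hlt (not_lt.2 h2)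
    · exact hasSign_iff_row.2 ⟨l, hpos, hrow⟩

/-- The mixed rank bound is open jointly in `t` and the placement; compactness of `[0, 1]` makes it
uniform in `t`. -/
lemma isOpen_hingeGeneric_hasSign (hcd : c ≠ d)
    (hM : ∀ q, rigidityRank (addHinges G a b c d) q ≤ M) (hlt : ∀ q, rigidityRank G q < M)
    (ε : ℤˣ) : IsOpen {p | HingeGeneric G a b c d M p ∧ HasSign G a b c d ε p} := by
  rw [isOpen_iff_mem_nhds]
  rintro p ⟨hp, hs⟩
  have hopen := isOpen_le_mixedRank G a b c d ε M
  have h1 : ∀ᶠ q in 𝓝 p, ∀ t ∈ Set.Icc (0 : ℝ) 1,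
      M ≤ finrank ℝ ↥(rowSpace G q ⊔ ℝ ∙ mixedRow a b c d ε t q) := by
    refine isCompact_Icc.eventually_forall_of_forall_eventually fun t ht => ?_
    have h2 := (hp.hasSign_iff_mixedRank hcd hM (hlt p) ε).1 hs t ht
    have h3 : ∀ᶠ x : ℝ × (W → E3) in 𝓝 (t, p),
        M ≤ finrank ℝ ↥(rowSpace G x.2 ⊔ ℝ ∙ mixedRow a b c d ε x.1 x.2) :=
      hopen.eventually_mem (x := (t, p)) h2
    exact (continuous_swap.tendsto (p, t)).eventually h3
  filter_upwards [h1, (isOpen_le_rigidityRank _ M).mem_nhds hp.1,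
    (isOpen_le_rigidityRank _ M).mem_nhds hp.2] with q h1 h2 h3
  exact ⟨⟨h2, h3⟩, (HingeGeneric.hasSign_iff_mixedRank hcd hM (hlt q) ⟨h2, h3⟩ ε).2 h1⟩

end

/-! ### Similarities -/

/-- Similarities of Euclidean space (with possibly negative scaling factor). -/
def IsSimilarity (k : E3 → E3) : Prop :=
  ∃ (A : E3 ≃ₗᵢ[ℝ] E3) (c : ℝ) (t : E3), c ≠ 0 ∧ ∀ v, k v = c • A v + t

lemma IsSimilarity.injective {k : E3 → E3} (hk : IsSimilarity k) : Function.Injective k := by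
  obtain ⟨A, c, t, hc, hk⟩ := hk
  intro x y h
  rw [hk, hk, add_left_inj] at h
  exact A.injective (smul_right_injective _ hc h)

lemma IsSimilarity.comp {k k' : E3 → E3} (hk : IsSimilarity k) (hk' : IsSimilarity k') :
    IsSimilarity (k ∘ k') := by
  obtain ⟨A, c, t, hc, hk⟩ := hk
  obtain ⟨A', c', t', hc', hk'⟩ := hk'
  refine ⟨A'.trans A, c * c', c • A t' + t, mul_ne_zero hc hc', fun v => ?_⟩
  simp [hk, hk', smul_smul, add_assoc]

/-- All stretches scale by the same factor, so ranks and ratios of stretches are invariant under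
similarities. -/
lemma stretch_similarity {V : Type*} {k : E3 → E3} {A : E3 ≃ₗᵢ[ℝ] E3} {c : ℝ} {t : E3}
    (hk : ∀ v, k v = c • A v + t) (p m : V → E3) (u v : V) :
    stretch (k ∘ p) (fun w => A (m w)) u v = c * stretch p m u v := by
  simp only [stretch, Function.comp, hk, add_sub_add_right_eq_sub, ← smul_sub, ← map_sub,
    inner_smul_left, LinearIsometryEquiv.inner_map_map]
  simp

lemma motions_similarity {V : Type*} (G : SimpleGraph V) {k : E3 → E3} {A : E3 ≃ₗᵢ[ℝ] E3} {c : ℝ}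
    {t : E3} (hc : c ≠ 0) (hk : ∀ v, k v = c • A v + t) (p : V → E3) :
    motions G (k ∘ p) = (motions G p).map
      (LinearEquiv.piCongrRight fun _ : V => A.toLinearEquiv).toLinearMap := by
  ext m
  rw [Submodule.mem_map]
  constructor
  · intro hm
    refine ⟨fun w => A.symm (m w), fun u v huv => ?_, by ext; simp⟩
    have h1 := stretch_similarity hk p (fun w => A.symm (m w)) u v
    simp only [LinearIsometryEquiv.apply_symm_apply] at h1
    have h2 : stretch (k ∘ p) m u v = 0 := hm u v huv
    rw [h2] at h1
    exact (mul_eq_zero.1 h1.symm).resolve_left hc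
  · rintro ⟨m', hm', rfl⟩ u v huv
    have h1 := stretch_similarity hk p m' u v
    have h2 : stretch p m' u v = 0 := hm' u v huv
    rw [h2, mul_zero] at h1
    exact h1

lemma rigidityRank_similarity {V : Type*} [Finite V] (G : SimpleGraph V) {k : E3 → E3}
    (hk : IsSimilarity k) (p : V → E3) : rigidityRank G (k ∘ p) = rigidityRank G p := by
  have := Fintype.ofFinite V
  obtain ⟨A, c, t, hc, hk⟩ := hk
  have h1 := rigidityRank_add_finrank_motions G p
  have h2 := rigidityRank_add_finrank_motions G (k ∘ p)
  rw [motions_similarity G hc hk, LinearEquiv.finrank_map_eq] at h2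
  omega

lemma HingeGeneric.similarity {W : Type*} [Finite W] {G : SimpleGraph W} {a b c d : W} {M : ℕ}
    {p : W → E3} (hp : HingeGeneric G a b c d M p) {k : E3 → E3} (hk : IsSimilarity k) :
    HingeGeneric G a b c d M (k ∘ p) := by
  rw [HingeGeneric, rigidityRank_similarity _ hk, rigidityRank_similarity _ hk]
  exact hp

lemma HasSign.similarity {W : Type*} {G : SimpleGraph W} {a b c d : W} {ε : ℤˣ}
    {p : W → E3} (hp : HasSign G a b c d ε p) {k : E3 → E3} (hk : IsSimilarity k) :
    HasSign G a b c d ε (k ∘ p) := by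
  obtain ⟨l, hl, h⟩ := hp
  obtain ⟨A, s, t, hs, hk⟩ := hk
  refine ⟨l, hl, fun m hm => ?_⟩
  rw [motions_similarity G hs hk] at hm
  obtain ⟨m', hm', rfl⟩ := hm
  have h1 := stretch_similarity hk p m' a b
  have h2 := stretch_similarity hk p m' c d
  have h3 := h m' hm'
  rw [h3] at h1
  refine h1.trans ?_
  rw [mul_left_comm, ← h2]
  rfl

/-- A rotation whose square takes `u` to `u'`. -/
lemma exists_isometry_sq {u u' : E3} (h : ‖u‖ = ‖u'‖) : ∃ A : E3 ≃ₗᵢ[ℝ] E3, A (A u) = u' := by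
  have hdim : 0 < finrank ℝ (ℝ ∙ (u - u'))ᗮ := by
    have h1 := Submodule.finrank_add_finrank_orthogonal (ℝ ∙ (u - u'))
    have h2 : finrank ℝ (ℝ ∙ (u - u')) ≤ 1 := (finrank_span_le_card _).trans (by simp)
    have h3 : finrank ℝ E3 = 3 := by simp
    omega
  have : Nontrivial (ℝ ∙ (u - u'))ᗮ := finrank_pos_iff.1 hdim
  obtain ⟨⟨w, hw⟩, hw0⟩ := exists_ne (0 : (ℝ ∙ (u - u'))ᗮ)
  have hw0 : w ≠ 0 := fun h => hw0 (by ext1; exact h)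
  -- `w'` has the norm of `u` and is orthogonal to `u - u'`. The reflection swapping `u` and `w'`,
  -- followed by the one swapping `u` and `u'` (which fixes `w'`), takes `u` to `w'` and `w'` to
  -- `u'`.
  set w' : E3 := (‖u‖ / ‖w‖) • w with hw'
  have hw'n : ‖u‖ = ‖w'‖ := by
    rw [hw', norm_smul, norm_div, norm_norm, norm_norm,
      div_mul_cancel₀ _ (norm_ne_zero_iff.2 hw0)]
  have hw'mem : w' ∈ (ℝ ∙ (u - u'))ᗮ := Submodule.smul_mem _ _ hw
  refine ⟨(ℝ ∙ (u - w'))ᗮ.reflection.trans (ℝ ∙ (u - u'))ᗮ.reflection, ?_⟩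
  have e1 : (ℝ ∙ (u - w'))ᗮ.reflection u = w' := Submodule.reflection_sub hw'n
  have e2 : (ℝ ∙ (u - w'))ᗮ.reflection w' = u := by
    have := Submodule.reflection_reflection (ℝ ∙ (u - w'))ᗮ u
    rwa [e1] at this
  have e3 : (ℝ ∙ (u - u'))ᗮ.reflection u = u' := Submodule.reflection_sub h
  have e4 : (ℝ ∙ (u - u'))ᗮ.reflection w' = w' :=
    Submodule.reflection_mem_subspace_eq_self hw'mem
  simp only [LinearIsometryEquiv.trans_apply, e1, e4, e2, e3]

/-- Ordered pairs of points are connected by squares of similarities. -/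
lemma pair_induction {r : E3 × E3 → E3 × E3 → Prop}
    (hr : ∀ x : E3 × E3, x.1 ≠ x.2 → ∀ k, IsSimilarity k → r x (k (k x.1), k (k x.2)))
    (htrans : ∀ x y z : E3 × E3, x.1 ≠ x.2 → y.1 ≠ y.2 → z.1 ≠ z.2 → r x y → r y z → r x z)
    (x x' : E3 × E3) (hx : x.1 ≠ x.2) (hx' : x'.1 ≠ x'.2) : r x x' := by
  -- A translation is the square of the translation by half the vector.
  have transl : ∀ (y : E3 × E3) (t : E3), y.1 ≠ y.2 → r y (y.1 + t, y.2 + t) := by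
    intro y t hy
    have := hr y hy (fun v => v + (2⁻¹ : ℝ) • t)
      ⟨LinearIsometryEquiv.refl ℝ E3, 1, (2⁻¹ : ℝ) • t, one_ne_zero, fun v => by simp⟩
    have h2 : (2⁻¹ : ℝ) • t + (2⁻¹ : ℝ) • t = t := by rw [← add_smul]; norm_num
    simpa only [add_assoc, h2] using this
  have h1 := transl x (-x.1) hx
  have h3 := transl (0, x'.2 - x'.1) x'.1 (by simpa [eq_comm, sub_eq_zero] using hx')
  simp only [add_neg_cancel, ← sub_eq_add_neg] at h1
  simp only [zero_add, sub_add_cancel] at h3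
  have hu : x.2 - x.1 ≠ 0 := sub_ne_zero.2 (Ne.symm hx)
  have hu' : x'.2 - x'.1 ≠ 0 := sub_ne_zero.2 (Ne.symm hx')
  generalize x.2 - x.1 = u at h1 hu
  generalize hud : x'.2 - x'.1 = u' at h3 hu'
  have hn := norm_pos_iff.2 hu
  have hn' := norm_pos_iff.2 hu'
  -- The square root of the length ratio is the scaling whose square matches the lengths; `A`
  -- supplies the square root of the rotation.
  have h2 : r (0, u) (0, u') := by
    obtain ⟨A, hA⟩ := exists_isometry_sq (u := u) (u' := (‖u‖ / ‖u'‖) • u') (by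
      rw [norm_smul, norm_div, norm_norm, norm_norm, div_mul_cancel₀ _ hn'.ne'])
    set s := Real.sqrt (‖u'‖ / ‖u‖) with hs
    have hss : s * s = ‖u'‖ / ‖u‖ := Real.mul_self_sqrt (by positivity)
    have := hr (0, u) (by simpa [eq_comm] using hu) (fun v => s • A v)
      ⟨A, s, 0, by positivity, fun v => by simp⟩
    simp only [map_zero, smul_zero, map_smul, hA, smul_smul] at this
    have h5 : s * s * (‖u‖ / ‖u'‖) = 1 := by rw [hss]; field_simp
    rw [← mul_assoc, h5, one_smul] at this
    exact this
  have n0 : (0 : E3) ≠ u := Ne.symm hu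
  have n0' : (0 : E3) ≠ u' := Ne.symm hu'
  exact htrans _ (0, u) _ hx n0 hx' h1 (htrans _ (0, u') _ n0 n0' hx' h2 h3)

lemma exists_similarity (x x' : E3 × E3) (hx : x.1 ≠ x.2) (hx' : x'.1 ≠ x'.2) :
    ∃ k, IsSimilarity k ∧ k x.1 = x'.1 ∧ k x.2 = x'.2 := by
  refine pair_induction (r := fun x x' => ∃ k, IsSimilarity k ∧ k x.1 = x'.1 ∧ k x.2 = x'.2)
    (fun x _ k hk => ⟨k ∘ k, hk.comp hk, rfl, rfl⟩) ?_ x x' hx hx'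
  rintro x y z - - - ⟨k, hk, h1, h2⟩ ⟨k', hk', h1', h2'⟩
  exact ⟨k' ∘ k, hk'.comp hk, by simp [h1, h1'], by simp [h2, h2']⟩

/-! ### Sign relations and their constancy. -/

/-- A sign relation on pairs of hinge positions `x`, `y`, as realized by the frameworks of one
member of a ring: it is defined for almost all pairs, is locally constant, invariant under
similarities, and multiplicative around rectangles of positions. -/
structure IsSignRelation (T : ℤˣ → E3 × E3 → E3 × E3 → Prop) : Prop where
  ne_left : ∀ {ε x y}, T ε x y → x.1 ≠ x.2
  ne_right : ∀ {ε x y}, T ε x y → y.1 ≠ y.2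
  open_left : ∀ {ε x y}, T ε x y → ∀ᶠ x' in 𝓝 x, T ε x' y
  open_right : ∀ {ε x y}, T ε x y → ∀ᶠ y' in 𝓝 y, T ε x y'
  dense_right : ∀ x : E3 × E3, x.1 ≠ x.2 → Dense {y | ∃ ε, T ε x y}
  dense_left : ∀ y : E3 × E3, y.1 ≠ y.2 → Dense {x | ∃ ε, T ε x y}
  similarity : ∀ {ε x y k}, IsSimilarity k → T ε x y → T ε (k x.1, k x.2) (k y.1, k y.2)
  exchange : ∀ {e₁₁ e₁₂ e₂₁ e₂₂ x₁ x₂ y₁ y₂}, T e₁₁ x₁ y₁ → T e₁₂ x₁ y₂ → T e₂₁ x₂ y₁ →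
    T e₂₂ x₂ y₂ → e₁₁ * e₁₂ * e₂₁ * e₂₂ = 1

namespace IsSignRelation

variable {T : ℤˣ → E3 × E3 → E3 × E3 → Prop} (hT : IsSignRelation T)
include hT

lemma swap : IsSignRelation fun ε x y => T ε y x where
  ne_left := hT.ne_right
  ne_right := hT.ne_left
  open_left := hT.open_right
  open_right := hT.open_left
  dense_right := hT.dense_left
  dense_left := hT.dense_right
  similarity := hT.similarity
  exchange h₁ h₂ h₃ h₄ := by
    rw [← hT.exchange h₁ h₃ h₂ h₄]; exact congrArg (· * _) (mul_right_comm _ _ _)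

/-- The degenerate rectangle with all corners at `(x, y)` gives `ε * ε * ε * ε' = 1`. -/
lemma unique {ε ε' x y} (h : T ε x y) (h' : T ε' x y) : ε = ε' := by
  have := hT.exchange h h h h'
  rcases Int.units_eq_one_or ε with rfl | rfl <;> rcases Int.units_eq_one_or ε' with rfl | rfl <;>
    simp_all

lemma isOpen_right (x : E3 × E3) : IsOpen {y | ∃ ε, T ε x y} := by
  rw [isOpen_iff_mem_nhds]
  rintro y ⟨ε, h⟩
  filter_upwards [hT.open_right h] with y' h'
  exact ⟨ε, h'⟩

lemma isOpen_both (x x' : E3 × E3) : IsOpen {y | ∃ ε, T ε x y ∧ T ε x' y} := by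
  rw [isOpen_iff_mem_nhds]
  rintro y ⟨ε, h, h'⟩
  filter_upwards [hT.open_right h, hT.open_right h'] with y' h h'
  exact ⟨ε, h, h'⟩

/-- Passing from `x` to its image under `k ∘ k` does not change the sign at almost every `y`, and
such steps connect all hinge positions. Openness is what lets the dense sets of consecutive steps be
intersected. -/
lemma dense_both {x x' : E3 × E3} (hx : x.1 ≠ x.2) (hx' : x'.1 ≠ x'.2) :
    Dense {y | ∃ ε, T ε x y ∧ T ε x' y} := by
  refine pair_induction (r := fun x x' => Dense {y | ∃ ε, T ε x y ∧ T ε x' y}) ?_ ?_ x x' hx hx'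
  · intro x hx k hk
    have hx1 : k x.1 ≠ k x.2 := hk.injective.ne hx
    have hx2 : k (k x.1) ≠ k (k x.2) := hk.injective.ne hx1
    have hd := ((hT.dense_right x hx).inter_of_isOpen_left (hT.dense_right (k x.1, k x.2) hx1)
      (hT.isOpen_right _)).inter_of_isOpen_left (hT.dense_right (k (k x.1), k (k x.2)) hx2)
      ((hT.isOpen_right _).inter (hT.isOpen_right _))
    refine hd.mono ?_
    rintro y ⟨⟨⟨ε₀, h₀⟩, ⟨ε₁, h₁⟩⟩, ⟨ε₂, h₂⟩⟩
    have := hT.exchange h₁ (hT.similarity hk h₀) h₂ (hT.similarity hk h₁)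
    have h : ε₂ = ε₀ := by
      rcases Int.units_eq_one_or ε₀ with rfl | rfl <;>
        rcases Int.units_eq_one_or ε₁ with rfl | rfl <;>
        rcases Int.units_eq_one_or ε₂ with rfl | rfl <;> simp_all
    subst h
    exact ⟨ε₂, h₀, h₂⟩
  · intro x y z _ _ _ hxy hyz
    refine (hxy.inter_of_isOpen_left hyz (hT.isOpen_both _ _)).mono ?_
    rintro w ⟨⟨ε, h1, h2⟩, ⟨ε', h3, h4⟩⟩
    obtain rfl := hT.unique h2 h3
    exact ⟨ε, h1, h4⟩

/-- The sign is the same at all pairs of hinge positions. -/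
lemma const {ε ε' x y x' y'} (h : T ε x y) (h' : T ε' x' y') : ε = ε' := by
  -- Near `x` there is `x₁` with equal signs against `y` and `y'`. A `y₁` near `y'` with equal signs
  -- against `x₁` and `x'` then completes the path.
  obtain ⟨x₁, ⟨e, hx₁, hx₁'⟩, hx₁T⟩ :=
    (hT.swap.dense_both (hT.ne_right h) (hT.ne_right h')).inter_nhds_nonempty (hT.open_left h)
  obtain rfl := hT.unique hx₁T hx₁
  obtain ⟨y₁, ⟨e', hy, hy'⟩, hyT, hyT'⟩ :=
    (hT.dense_both (hT.ne_left hx₁) (hT.ne_left h')).inter_nhds_nonempty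
      ((hT.open_right hx₁').and (hT.open_right h'))
  rw [hT.unique hyT hy, hT.unique hyT' hy']

end IsSignRelation

/-! ### Placements with prescribed hinge positions -/

open Classical in
/-- The placement `p` with `u`, `v` moved to `x.1`, `x.2`. -/
noncomputable def placeAt {W : Type*} (p : W → E3) (u v : W) (x : E3 × E3) : W → E3 :=
  Function.update (Function.update p u x.1) v x.2

section
variable {W : Type*} {p : W → E3} {u v : W} {x : E3 × E3}

lemma placeAt_left (huv : u ≠ v) : placeAt p u v x u = x.1 := by
  classical
  simp [placeAt, Function.update_of_ne huv]

lemma placeAt_right : placeAt p u v x v = x.2 := by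
  classical
  simp [placeAt]

lemma placeAt_of_ne {w : W} (hu : w ≠ u) (hv : w ≠ v) : placeAt p u v x w = p w := by
  classical
  simp [placeAt, Function.update_of_ne hu, Function.update_of_ne hv]

lemma placeAt_self (hu : p u = x.1) (hv : p v = x.2) : placeAt p u v x = p := by
  classical
  rw [placeAt, ← hu, Function.update_eq_self, ← hv, Function.update_eq_self]

lemma continuous_placeAt (p : W → E3) (u v : W) : Continuous (placeAt p u v) := by
  classical
  exact ((continuous_const (y := p)).update u continuous_fst).update v continuous_snd

lemma continuous_placeAt_left (u v : W) (x : E3 × E3) : Continuous fun p => placeAt p u v x := by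
  classical
  exact (continuous_id.update u continuous_const).update v continuous_const

lemma analyticAt_placeAt [Fintype W] (u v : W) (x : E3 × E3) (w : W) (e : W → E3) :
    AnalyticAt ℝ (fun e => placeAt e u v x w) e := by
  classical
  unfold placeAt
  by_cases hv : w = v
  · subst hv; simpa using analyticAt_const
  by_cases hu : w = u
  · subst hu; simpa [Function.update_of_ne hv] using analyticAt_const
  · simp only [Function.update_of_ne hu, Function.update_of_ne hv]
    exact (ContinuousLinearMap.proj (R := ℝ) (φ := fun _ : W => E3) w).analyticAt e

variable [Finite W] {G : SimpleGraph W} {a b c d : W} {M : ℕ}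

lemma isOpen_hingeGeneric (G : SimpleGraph W) (a b c d : W) (M : ℕ) :
    IsOpen {p | HingeGeneric G a b c d M p} :=
  (isOpen_le_rigidityRank _ M).inter (isOpen_le_rigidityRank _ M)

lemma dense_hingeGeneric (h : HingeGeneric G a b c d M p) :
    Dense {p | HingeGeneric G a b c d M p} := by
  have := Fintype.ofFinite W
  have hg : ∀ (u : W) (e : W → E3), AnalyticAt ℝ (fun e : W → E3 => e u) e := fun u e =>
    (ContinuousLinearMap.proj (R := ℝ) (φ := fun _ : W => E3) u).analyticAt e
  exact (dense_le_rigidityRank _ (g := id) hg ⟨p, h.1⟩).inter_of_isOpen_left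
    (dense_le_rigidityRank _ (g := id) hg ⟨p, h.2⟩) (isOpen_le_rigidityRank _ M)

lemma isOpen_hingeGeneric_placeAt (G : SimpleGraph W) (a b c d : W) (M : ℕ) (u v : W)
    (x : E3 × E3) : IsOpen {e | HingeGeneric G a b c d M (placeAt e u v x)} :=
  (isOpen_hingeGeneric G a b c d M).preimage (continuous_placeAt_left u v x)

/-- A similarity brings the given placement to one with `u`, `v` at `x`, so the rank bounds are
attained in this analytic family and hence hold densely. -/
lemma dense_hingeGeneric_placeAt (h : HingeGeneric G a b c d M p) (huv : p u ≠ p v)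
    (hx : x.1 ≠ x.2) : Dense {e | HingeGeneric G a b c d M (placeAt e u v x)} := by
  have := Fintype.ofFinite W
  obtain ⟨k, hk, h1, h2⟩ := exists_similarity (p u, p v) x huv hx
  have h' := h.similarity hk
  have hself : placeAt (k ∘ p) u v x = k ∘ p := placeAt_self h1 h2
  have hg := fun w e => analyticAt_placeAt u v x w e
  refine (dense_le_rigidityRank _ hg ⟨k ∘ p, ?_⟩).inter_of_isOpen_left
    (dense_le_rigidityRank _ hg ⟨k ∘ p, ?_⟩)
    ((isOpen_le_rigidityRank _ M).preimage (continuous_placeAt_left u v x))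
  · rw [hself]; exact h'.1
  · rw [hself]; exact h'.2

/-- If its endpoints coincided, a hinge would impose no condition and could not raise the rank. -/
lemma HingeGeneric.ne (hlt : rigidityRank G p < M) (h : HingeGeneric G a b c d M p) :
    p a ≠ p b ∧ p c ≠ p d := by
  have key : ∀ u v, M ≤ rigidityRank (G ⊔ SimpleGraph.edge u v) p → p u ≠ p v := by
    intro u v h huv
    have : rigidityRank (G ⊔ SimpleGraph.edge u v) p = rigidityRank G p := by
      refine rank_eq_of_motions_eq (Submodule.ext fun m => ?_)
      rw [mem_motions_sup_edge]
      exact ⟨fun h => h.1, fun h => ⟨h, by simp [stretch, huv]⟩⟩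
    omega
  exact ⟨key _ _ h.1, key _ _ h.2⟩

end

/-! ### Combinatorics of the ring -/

section
variable {n : ℕ} [NeZero n]

lemma fin_exists_pred (i : Fin n) : ∃ j, j + 1 = i := ⟨i - 1, sub_add_cancel i 1⟩

open Fin.CommRing in
lemma fin_cyclic_induction {P : Fin n → Prop} {i₀ : Fin n} (h₀ : P i₀)
    (h : ∀ i, P i → P (i + 1)) (i : Fin n) : P i := by
  have key : ∀ k : ℕ, P (i₀ + (k : Fin n)) := by
    intro k
    induction k with
    | zero => simpa using h₀
    | succ k ih =>
      have := h _ ih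
      rwa [add_assoc, ← Nat.cast_succ] at this
  have := key (i - i₀).val
  rwa [Fin.cast_val_eq_self, add_sub_cancel] at this

/-- From four members on, the predecessor and successor of a member are distinct and not neighbours,
so they share no vertex. -/
lemma fin_succ_ne (hn : 4 ≤ n) (j : Fin n) :
    j ≠ j + 1 ∧ j ≠ j + 1 + 1 ∧ j + 1 ≠ j + 1 + 1 ∧ j + 1 + 1 + 1 ≠ j := by
  have h1 : ((1 : Fin n) : ℕ) = 1 := by
    rw [Fin.val_one']; exact Nat.mod_eq_of_lt (by omega)
  have := j.isLt
  refine ⟨?_, ?_, ?_, ?_⟩ <;>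
  · simp only [ne_eq, Fin.ext_iff, Fin.val_add_eq_ite, h1]
    split_ifs <;> omega

end

section
variable {n : ℕ} [NeZero n] {W : Fin n → Type*} {G : ∀ i, SimpleGraph (W i)}
  {a b c d : ∀ i, W i} {V : Type*} {Γ : SimpleGraph V} {φ : ∀ i, W i ↪ V}

lemma IsRing.adj_iff (hr : IsRing G a b c d Γ φ) {u v : V} :
    Γ.Adj u v ↔ ∃ i x y, (G i).Adj x y ∧ φ i x = u ∧ φ i y = v := by
  rw [hr.graph_eq]
  simp [SimpleGraph.iSup_adj, SimpleGraph.map_adj]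

lemma IsRing.finite [∀ i, Finite (W i)] (hr : IsRing G a b c d Γ φ) : Finite V := by
  have : Function.Surjective (fun x : Σ i, W i => φ x.1 x.2) := fun v => by
    obtain ⟨i, w, h⟩ := hr.cover v
    exact ⟨⟨i, w⟩, h⟩
  exact Finite.of_surjective _ this

lemma IsRing.eq_hinge (hr : IsRing G a b c d Γ φ) {i : Fin n} {v : V}
    (h : v ∈ Set.range (φ i)) (h' : v ∈ Set.range (φ (i + 1))) :
    v = φ i (c i) ∨ v = φ i (d i) := by
  have : v ∈ Set.range (φ i) ∩ Set.range (φ (i + 1)) := ⟨h, h'⟩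
  rw [hr.inter] at this
  exact this

/-- Two members of the ring with a common vertex are equal or neighbours. -/
lemma IsRing.near (hr : IsRing G a b c d Γ φ) {i j : Fin n} {v : V}
    (h : v ∈ Set.range (φ i)) (h' : v ∈ Set.range (φ j)) : i = j ∨ j = i + 1 ∨ i = j + 1 := by
  by_contra hcon
  push Not at hcon
  exact Set.disjoint_left.1 (hr.disjoint i j hcon.1 hcon.2.1 hcon.2.2) h h'

lemma IsRing.glue_mem (hr : IsRing G a b c d Γ φ) (i : Fin n) :
    (φ i (c i) ∈ Set.range (φ (i + 1)) ∧ φ i (d i) ∈ Set.range (φ (i + 1))) ∧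
    (φ (i + 1) (a (i + 1)) ∈ Set.range (φ i) ∧ φ (i + 1) (b (i + 1)) ∈ Set.range (φ i)) :=
  ⟨⟨⟨_, (hr.glue_ca i).symm⟩, ⟨_, (hr.glue_db i).symm⟩⟩,
    ⟨⟨_, hr.glue_ca i⟩, ⟨_, hr.glue_db i⟩⟩⟩

/-- The two hinges of a member are disjoint. -/
lemma IsRing.hinges_ne (hr : IsRing G a b c d Γ φ) (hn : 4 ≤ n) (i : Fin n) :
    a i ≠ c i ∧ a i ≠ d i ∧ b i ≠ c i ∧ b i ≠ d i := by
  obtain ⟨j, rfl⟩ := fin_exists_pred i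
  obtain ⟨h1, h2, h3, h4⟩ := fin_succ_ne hn j
  have hd := Set.disjoint_left.1 (hr.disjoint j (j + 1 + 1) h2 (by simpa using h3.symm) h4.symm)
  obtain ⟨-, ha, hb⟩ := hr.glue_mem j
  obtain ⟨⟨hc, hdd⟩, -⟩ := hr.glue_mem (j + 1)
  refine ⟨fun h => hd ha ?_, fun h => hd ha ?_, fun h => hd hb ?_, fun h => hd hb ?_⟩ <;>
    rw [h] <;> assumption

lemma IsRing.motions_comp (hr : IsRing G a b c d Γ φ) {p m : V → E3} (hm : m ∈ motions Γ p)
    (i : Fin n) : m ∘ φ i ∈ motions (G i) (p ∘ φ i) := fun u v huv =>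
  hm _ _ (hr.adj_iff.2 ⟨i, u, v, huv, rfl, rfl⟩)

lemma IsRing.stretch_succ (hr : IsRing G a b c d Γ φ) (p m : V → E3) (i : Fin n) :
    stretch (p ∘ φ (i + 1)) (m ∘ φ (i + 1)) (a (i + 1)) (b (i + 1))
      = stretch (p ∘ φ i) (m ∘ φ i) (c i) (d i) := by
  simp only [stretch, Function.comp, hr.glue_ca, hr.glue_db]

/-- The ratios of the stretches of consecutive hinges multiply to one. -/
lemma IsRing.prod_ratio_eq_one (hr : IsRing G a b c d Γ φ) {p m : V → E3} {l : Fin n → ℝ}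
    (hl : ∀ i, stretch (p ∘ φ i) (m ∘ φ i) (a i) (b i)
      = l i * stretch (p ∘ φ i) (m ∘ φ i) (c i) (d i))
    (h : ∀ i, stretch (p ∘ φ i) (m ∘ φ i) (c i) (d i) ≠ 0) : ∏ i, l i = 1 := by
  set s := fun i => stretch (p ∘ φ i) (m ∘ φ i) (c i) (d i) with hs
  have h1 : ∀ i, s i = l (i + 1) * s (i + 1) := fun i => by
    rw [← hl (i + 1), hr.stretch_succ]
  have h2 : ∏ i, s i = (∏ i, l i) * ∏ i, s i := by
    calc ∏ i, s i = ∏ i, l (i + 1) * s (i + 1) := Finset.prod_congr rfl fun i _ => h1 i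
      _ = ∏ i, l i * s i := Equiv.prod_comp (Equiv.addRight 1) fun i => l i * s i
      _ = _ := Finset.prod_mul_distrib
  have h3 : ∏ i, s i ≠ 0 := Finset.prod_ne_zero_iff.2 fun i _ => h i
  exact mul_right_cancel₀ h3 (by rw [one_mul]; exact h2.symm)

/-- Extending a placement of one member of the ring. -/
lemma IsRing.extend_comp (hr : IsRing G a b c d Γ φ) (j : Fin n)
    (p : W (j + 1) → E3) (e : V → E3) :
    let q := Function.extend (φ (j + 1)) p e
    q ∘ φ (j + 1) = p ∧
    q ∘ φ j = placeAt (e ∘ φ j) (c j) (d j) (p (a (j + 1)), p (b (j + 1))) ∧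
    q ∘ φ (j + 1 + 1) = placeAt (e ∘ φ (j + 1 + 1)) (a (j + 1 + 1)) (b (j + 1 + 1))
      (p (c (j + 1)), p (d (j + 1))) ∧
    ∀ k, k ≠ j → k ≠ j + 1 → k ≠ j + 1 + 1 → q ∘ φ k = e ∘ φ k := by
  intro q
  have hq : ∀ w, q (φ (j + 1) w) = p w := fun w => (φ (j + 1)).injective.extend_apply _ _ _
  have hq' : ∀ v, v ∉ Set.range (φ (j + 1)) → q v = e v := fun v hv =>
    Function.extend_apply' _ _ _ fun ⟨w, hw⟩ => hv ⟨w, hw⟩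
  refine ⟨funext hq, ?_, ?_, ?_⟩
  · funext w
    by_cases hd : w = d j
    · subst hd; rw [placeAt_right, Function.comp, hr.glue_db, hq]
    by_cases hc : w = c j
    · subst hc; rw [placeAt_left (hr.ne_cd j), Function.comp, hr.glue_ca, hq]
    rw [placeAt_of_ne hc hd]
    refine hq' _ fun h => ?_
    rcases hr.eq_hinge ⟨w, rfl⟩ h with h | h
    · exact hc ((φ j).injective h)
    · exact hd ((φ j).injective h)
  · funext w
    by_cases hb : w = b (j + 1 + 1)
    · subst hb; rw [placeAt_right, Function.comp, ← hr.glue_db, hq]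
    by_cases ha : w = a (j + 1 + 1)
    · subst ha; rw [placeAt_left (hr.ne_ab _), Function.comp, ← hr.glue_ca, hq]
    rw [placeAt_of_ne ha hb]
    refine hq' _ fun h => ?_
    rcases hr.eq_hinge h ⟨w, rfl⟩ with h | h
    · rw [hr.glue_ca] at h; exact ha ((φ _).injective h)
    · rw [hr.glue_db] at h; exact hb ((φ _).injective h)
  · intro k h1 h2 h3
    funext w
    refine hq' _ fun h => ?_
    rcases hr.near h ⟨w, rfl⟩ with h | h | h
    · exact h2 h.symm
    · exact h3 h
    · exact h1 (add_right_cancel h).symm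

end

/-! ### Signs of ring members and the contradiction around the ring. -/

/-- The hinge-generic placements of `G` with hinges at `x` and `y` and sign `ε` exist. -/
def SignAt {W : Type*} (G : SimpleGraph W) (a b c d : W) (M : ℕ) (ε : ℤˣ) (x y : E3 × E3) : Prop :=
  ∃ p, (HingeGeneric G a b c d M p ∧ HasSign G a b c d ε p) ∧
    (p a = x.1 ∧ p b = x.2) ∧ p c = y.1 ∧ p d = y.2

lemma dense_image_pair {W : Type*} [Finite W] {u v : W} (huv : u ≠ v) {s : Set (W → E3)}
    (hs : Dense s) : Dense ((fun e : W → E3 => (e u, e v)) '' s) := by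
  refine DenseRange.dense_image (Function.Surjective.denseRange fun x => ?_) (by fun_prop) hs
  refine ⟨placeAt 0 u v x, ?_⟩
  rw [placeAt_left huv, placeAt_right]

lemma dense_preimage_comp {V W : Type*} [Finite V] [Finite W] (f : W ↪ V) {s : Set (W → E3)}
    (hs : Dense s) :
    Dense {e : V → E3 | e ∘ f ∈ s} := by
  classical
  have hopen : IsOpenMap fun e : V → E3 => e ∘ f := by
    let r : (V → E3) →L[ℝ] (W → E3) :=
      ContinuousLinearMap.pi fun w => ContinuousLinearMap.proj (f w)
    have := Fintype.ofFinite V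
    have := Fintype.ofFinite W
    refine ContinuousLinearMap.isOpenMap r ?_
    intro p
    exact ⟨Function.extend f p 0, funext fun w => f.injective.extend_apply _ _ _⟩
  exact hs.preimage hopen

lemma continuous_comp_embedding {V W : Type*} (f : W ↪ V) :
    Continuous fun e : V → E3 => e ∘ f := by
  unfold Function.comp; fun_prop

section
variable {n : ℕ} [NeZero n] {W : Fin n → Type*} [∀ i, Finite (W i)] {G : ∀ i, SimpleGraph (W i)}
  {a b c d : ∀ i, W i} {V : Type*} {Γ : SimpleGraph V} {φ : ∀ i, W i ↪ V} {M : Fin n → ℕ}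
  {p₀ : ∀ i, W i → E3}

/-- Frameworks of one member with hinge positions in a rectangle have signs of product one: the
rest of the ring can be placed consistently. -/
lemma IsRing.signAt_exchange (hr : IsRing G a b c d Γ φ) (hn : 4 ≤ n)
    (hM : ∀ i q, rigidityRank (addHinges (G i) (a i) (b i) (c i) (d i)) q ≤ M i)
    (hlt : ∀ i q, rigidityRank (G i) q < M i)
    (h₀ : ∀ i, HingeGeneric (G i) (a i) (b i) (c i) (d i) (M i) (p₀ i))
    (hprod : ∀ (p : V → E3) (ε : Fin n → ℤˣ),
      (∀ i, HingeGeneric (G i) (a i) (b i) (c i) (d i) (M i) (p ∘ φ i) ∧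
        HasSign (G i) (a i) (b i) (c i) (d i) (ε i) (p ∘ φ i)) → ∏ i, ε i = 1)
    (i : Fin n) {e : Fin 2 → Fin 2 → ℤˣ} {x y : Fin 2 → E3 × E3}
    (h : ∀ s t, SignAt (G i) (a i) (b i) (c i) (d i) (M i) (e s t) (x s) (y t)) :
    e 0 0 * e 0 1 * e 1 0 * e 1 1 = 1 := by
  classical
  have := hr.finite
  obtain ⟨j, rfl⟩ := fin_exists_pred i
  obtain ⟨hj1, hj2, hj3, hj4⟩ := fin_succ_ne hn j
  choose p hp hpx hpy using h
  have hx : ∀ s, (x s).1 ≠ (x s).2 := fun s => by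
    rw [← (hpx s 0).1, ← (hpx s 0).2]; exact ((hp s 0).1.ne (hlt _ _)).1
  have hy : ∀ t, (y t).1 ≠ (y t).2 := fun t => by
    rw [← (hpy 0 t).1, ← (hpy 0 t).2]; exact ((hp 0 t).1.ne (hlt _ _)).2
  let S : Set (V → E3) := {e | ∀ k,
    HingeGeneric (G k) (a k) (b k) (c k) (d k) (M k) (e ∘ φ k)}
  let X : Fin 2 → Set (V → E3) := fun s => {e |
    HingeGeneric (G j) (a j) (b j) (c j) (d j) (M j) (placeAt (e ∘ φ j) (c j) (d j) (x s))}
  let Y : Fin 2 → Set (V → E3) := fun t => {e |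
    HingeGeneric (G (j + 1 + 1)) (a (j + 1 + 1)) (b (j + 1 + 1)) (c (j + 1 + 1)) (d (j + 1 + 1))
      (M (j + 1 + 1)) (placeAt (e ∘ φ (j + 1 + 1)) (a (j + 1 + 1)) (b (j + 1 + 1)) (y t))}
  have hX : ∀ s, Dense (X s) ∧ IsOpen (X s) := fun s =>
    ⟨dense_preimage_comp (φ j) (dense_hingeGeneric_placeAt (h₀ j) ((h₀ j).ne (hlt _ _)).2 (hx s)),
      (isOpen_hingeGeneric_placeAt _ _ _ _ _ _ _ _ _).preimage (continuous_comp_embedding (φ j))⟩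
  have hY : ∀ t, Dense (Y t) ∧ IsOpen (Y t) := fun t =>
    ⟨dense_preimage_comp (φ (j + 1 + 1))
      (dense_hingeGeneric_placeAt (h₀ _) ((h₀ _).ne (hlt _ _)).1 (hy t)),
      (isOpen_hingeGeneric_placeAt _ _ _ _ _ _ _ _ _).preimage (continuous_comp_embedding _)⟩
  have hS : Dense S := by
    have : S = ⋂ k, {e | HingeGeneric (G k) (a k) (b k) (c k) (d k) (M k) (e ∘ φ k)} := by
      ext; simp [S]
    rw [this]
    exact dense_iInter_of_isOpen
      (fun k => (isOpen_hingeGeneric _ _ _ _ _ _).preimage (continuous_comp_embedding (φ k)))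
      (fun k => dense_preimage_comp (φ k) (dense_hingeGeneric (h₀ k)))
  -- One background placement `q` for all four corners: every member is hinge-generic in it, and the
  -- two neighbours remain so when their shared hinge is moved to any of the prescribed positions.
  obtain ⟨q, ⟨⟨⟨hqS, hX0⟩, hX1⟩, hY0⟩, hY1⟩ :=
    ((((hS.inter_of_isOpen_right (hX 0).1 (hX 0).2).inter_of_isOpen_right (hX 1).1
      (hX 1).2).inter_of_isOpen_right (hY 0).1 (hY 0).2).inter_of_isOpen_right (hY 1).1
      (hY 1).2).nonempty
  have hqX : ∀ s, q ∈ X s := by intro s; fin_cases s <;> assumption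
  have hqY : ∀ t, q ∈ Y t := by intro t; fin_cases t <;> assumption
  choose ζ hζ using fun k => (hqS k).exists_sign (hM k)
  choose η hη using fun s => HingeGeneric.exists_sign (hM j) (hqX s)
  choose θ hθ using fun t => HingeGeneric.exists_sign (hM (j + 1 + 1)) (hqY t)
  let F : Fin 2 → Fin 2 → Fin n → ℤˣ := fun s t k =>
    if k = j + 1 then e s t else if k = j then η s else if k = j + 1 + 1 then θ t else ζ k
  have hF : ∀ s t, ∏ k, F s t k = 1 := by
    intro s t
    obtain ⟨h1, h2, h3, h4⟩ := hr.extend_comp j (p s t) q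
    rw [(hpx s t).1, (hpx s t).2] at h2
    rw [(hpy s t).1, (hpy s t).2] at h3
    refine hprod (Function.extend (φ (j + 1)) (p s t) q) _ fun k => ?_
    by_cases hk1 : k = j + 1
    · subst hk1
      simp only [F, if_true]
      rw [h1]
      exact hp s t
    by_cases hk : k = j
    · subst hk
      simp only [F, if_neg hk1, if_true]
      rw [h2]
      exact ⟨hqX s, hη s⟩
    by_cases hk2 : k = j + 1 + 1
    · subst hk2
      simp only [F, if_neg hk1, if_neg hk, if_true]
      rw [h3]
      exact ⟨hqY t, hθ t⟩
    · simp only [F, if_neg hk1, if_neg hk, if_neg hk2]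
      rw [h4 k hk hk1 hk2]
      exact ⟨hqS k, hζ k⟩
  have hall : ∏ k, F 0 0 k * F 0 1 k * F 1 0 k * F 1 1 k = 1 := by
    simp only [Finset.prod_mul_distrib, hF, mul_one]
  rw [Finset.prod_eq_single (j + 1)] at hall
  · simpa [F] using hall
  -- The predecessor's sign depends only on `s`, the successor's only on `t`, all others on neither;
  -- in the product over four corners each cancels in pairs.
  · intro k _ hk1
    simp only [F, if_neg hk1]
    have sq : ∀ u : ℤˣ, u * u = 1 := Int.units_mul_self
    split_ifs
    · rw [sq, one_mul, sq]
    · rw [mul_assoc, mul_assoc, mul_comm (θ 1), mul_assoc, ← mul_assoc, ← mul_assoc, sq]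
      simp [sq]
    · rw [sq, one_mul, sq]
  · simp

/-- The hinges of a member are disjoint, so one can be moved while the other stays fixed; this gives
the openness and density conditions. -/
lemma IsRing.isSignRelation (hr : IsRing G a b c d Γ φ) (hn : 4 ≤ n)
    (hM : ∀ i q, rigidityRank (addHinges (G i) (a i) (b i) (c i) (d i)) q ≤ M i)
    (hlt : ∀ i q, rigidityRank (G i) q < M i)
    (h₀ : ∀ i, HingeGeneric (G i) (a i) (b i) (c i) (d i) (M i) (p₀ i))
    (hprod : ∀ (p : V → E3) (ε : Fin n → ℤˣ),
      (∀ i, HingeGeneric (G i) (a i) (b i) (c i) (d i) (M i) (p ∘ φ i) ∧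
        HasSign (G i) (a i) (b i) (c i) (d i) (ε i) (p ∘ φ i)) → ∏ i, ε i = 1)
    (i : Fin n) : IsSignRelation (SignAt (G i) (a i) (b i) (c i) (d i) (M i)) where
  ne_left := by
    rintro ε x y ⟨p, ⟨hp, -⟩, ⟨h1, h2⟩, -⟩
    rw [← h1, ← h2]; exact (hp.ne (hlt i p)).1
  ne_right := by
    rintro ε x y ⟨p, ⟨hp, -⟩, -, h1, h2⟩
    rw [← h1, ← h2]; exact (hp.ne (hlt i p)).2
  open_left := by
    rintro ε x y ⟨p, hp, hx, hy⟩
    obtain ⟨n1, n2, n3, n4⟩ := hr.hinges_ne hn i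
    have hself : placeAt p (a i) (b i) x = p := placeAt_self hx.1 hx.2
    have hev := (continuous_placeAt p (a i) (b i)).continuousAt (x := x)
      |>.eventually ((isOpen_hingeGeneric_hasSign (hr.ne_cd i) (hM i) (hlt i) ε).mem_nhds
        (by rw [hself]; exact hp))
    filter_upwards [hev] with x' hx'
    exact ⟨_, hx', ⟨placeAt_left (hr.ne_ab i), placeAt_right⟩,
      by rw [placeAt_of_ne n1.symm n3.symm, hy.1], by rw [placeAt_of_ne n2.symm n4.symm, hy.2]⟩
  open_right := by
    rintro ε x y ⟨p, hp, hx, hy⟩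
    obtain ⟨n1, n2, n3, n4⟩ := hr.hinges_ne hn i
    have hself : placeAt p (c i) (d i) y = p := placeAt_self hy.1 hy.2
    have hev := (continuous_placeAt p (c i) (d i)).continuousAt (x := y)
      |>.eventually ((isOpen_hingeGeneric_hasSign (hr.ne_cd i) (hM i) (hlt i) ε).mem_nhds
        (by rw [hself]; exact hp))
    filter_upwards [hev] with x' hx'
    exact ⟨_, hx', ⟨by rw [placeAt_of_ne n1 n2, hx.1], by rw [placeAt_of_ne n3 n4, hx.2]⟩,
      placeAt_left (hr.ne_cd i), placeAt_right⟩
  dense_right := by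
    intro x hx
    obtain ⟨n1, n2, n3, n4⟩ := hr.hinges_ne hn i
    refine (dense_image_pair (hr.ne_cd i) (dense_hingeGeneric_placeAt (h₀ i)
      ((h₀ i).ne (hlt i _)).1 hx)).mono ?_
    rintro _ ⟨e, he, rfl⟩
    obtain ⟨ε, hε⟩ := HingeGeneric.exists_sign (hM i) he
    exact ⟨ε, _, ⟨he, hε⟩, ⟨placeAt_left (hr.ne_ab i), placeAt_right⟩,
      placeAt_of_ne n1.symm n3.symm, placeAt_of_ne n2.symm n4.symm⟩
  dense_left := by
    intro y hy
    obtain ⟨n1, n2, n3, n4⟩ := hr.hinges_ne hn i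
    refine (dense_image_pair (hr.ne_ab i) (dense_hingeGeneric_placeAt (h₀ i)
      ((h₀ i).ne (hlt i _)).2 hy)).mono ?_
    rintro _ ⟨e, he, rfl⟩
    obtain ⟨ε, hε⟩ := HingeGeneric.exists_sign (hM i) he
    exact ⟨ε, _, ⟨he, hε⟩, ⟨placeAt_of_ne n1 n2, placeAt_of_ne n3 n4⟩,
      placeAt_left (hr.ne_cd i), placeAt_right⟩
  similarity := by
    rintro ε x y k hk ⟨p, ⟨hp, hs⟩, ⟨h1, h2⟩, h3, h4⟩
    exact ⟨k ∘ p, ⟨hp.similarity hk, hs.similarity hk⟩, ⟨by simp [h1], by simp [h2]⟩,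
      by simp [h3], by simp [h4]⟩
  exchange := by
    intro e₁₁ e₁₂ e₂₁ e₂₂ x₁ x₂ y₁ y₂ h₁ h₂ h₃ h₄
    exact hr.signAt_exchange hn hM hlt h₀ hprod i (e := ![![e₁₁, e₁₂], ![e₂₁, e₂₂]])
      (x := ![x₁, x₂]) (y := ![y₁, y₂]) (by
        intro s t
        fin_cases s <;> fin_cases t <;> assumption)

/-- If the signs of the members have product `-1`, the hinges are implied by the ring. -/
theorem IsRing.rigidityRow_mem (hr : IsRing G a b c d Γ φ) (hn : 4 ≤ n) {ε : Fin n → ℤˣ}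
    (hgen : ∀ i, IsGeneric (addHinges (G i) (a i) (b i) (c i) (d i)) (p₀ i))
    (hzero : ∀ i, ∀ m ∈ motions (G i) (p₀ i),
      stretch (p₀ i) m (a i) (b i) = 0 ↔ stretch (p₀ i) m (c i) (d i) = 0)
    (hsign : ∀ i, HasSign (G i) (a i) (b i) (c i) (d i) (ε i) (p₀ i))
    (hε : ∏ i, ε i = -1) {p : V → E3} (hp : IsGeneric Γ p) (i : Fin n) :
    rigidityRow p (φ i (c i)) (φ i (d i)) ∈ rowSpace Γ p := by
  have := hr.finite
  have := Fintype.ofFinite V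
  by_contra hcon
  set M := fun i => rigidityRank (addHinges (G i) (a i) (b i) (c i) (d i)) (p₀ i) with hMdef
  have hM : ∀ i q, rigidityRank (addHinges (G i) (a i) (b i) (c i) (d i)) q ≤ M i :=
    fun i q => hgen i q
  have h₀ : ∀ i, HingeGeneric (G i) (a i) (b i) (c i) (d i) (M i) (p₀ i) := fun i =>
    hingeGeneric_of_stretch_eq_zero_iff (hzero i)
  set Γ' := Γ ⊔ SimpleGraph.edge (φ i (c i)) (φ i (d i)) with hΓ'
  -- Placements where the hinge raises the rank beyond the generic rank of `Γ`, so that some motion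
  -- of `Γ` stretches it.
  let Q : Set (V → E3) := {q | rigidityRank Γ p + 1 ≤ rigidityRank Γ' q}
  have hpQ : p ∈ Q := by
    by_contra hle
    have heq := motions_eq_of_rank_le (G := Γ) (G' := Γ') le_sup_left (p := p) (by
      have : ¬ (rigidityRank Γ p + 1 ≤ rigidityRank Γ' p) := hle
      omega)
    refine hcon (mem_rowSpace_iff.2 fun m hm => ?_)
    rw [← heq, mem_motions_sup_edge] at hm
    rw [velocityDual_rigidityRow]
    exact hm.2
  have hQopen : IsOpen Q := isOpen_le_rigidityRank _ _
  have hQdense : Dense Q := dense_le_rigidityRank Γ' (g := id) (fun u e =>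
    (ContinuousLinearMap.proj (R := ℝ) (φ := fun _ : V => E3) u).analyticAt e) ⟨p, hpQ⟩
  have hQ : ∀ q ∈ Q, ∃ m ∈ motions Γ q,
      stretch (q ∘ φ i) (m ∘ φ i) (c i) (d i) ≠ 0 := by
    intro q hq
    by_contra hno
    push Not at hno
    have h1 : rigidityRank Γ' q = rigidityRank Γ q := by
      refine rank_eq_of_motions_eq (Submodule.ext fun m => ?_)
      rw [mem_motions_sup_edge]
      exact ⟨fun h => h.1, fun h => ⟨h, hno m h⟩⟩
    have h2 := hp q
    have h3 : rigidityRank Γ p + 1 ≤ rigidityRank Γ' q := hq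
    omega
  let C : Set (V → E3) := ⋂ k, {e | HingeGeneric (G k) (a k) (b k) (c k) (d k) (M k) (e ∘ φ k)}
  have hC : Dense C := dense_iInter_of_isOpen
      (fun k => (isOpen_hingeGeneric _ _ _ _ _ _).preimage (continuous_comp_embedding (φ k)))
      (fun k => dense_preimage_comp (φ k) (dense_hingeGeneric (h₀ k)))
  have hCm : ∀ {q}, q ∈ C → ∀ k,
      HingeGeneric (G k) (a k) (b k) (c k) (d k) (M k) (q ∘ φ k) := fun h k =>
    Set.mem_iInter.1 h k
  have hQC : Dense (Q ∩ C) := hQdense.inter_of_isOpen_left hC hQopen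
  have hmot : ∀ q ∈ Q ∩ C, ∃ m ∈ motions Γ q,
      ∀ k, stretch (q ∘ φ k) (m ∘ φ k) (c k) (d k) ≠ 0 := by
    rintro q ⟨hqQ, hqC⟩
    obtain ⟨m, hm, hne⟩ := hQ q hqQ
    refine ⟨m, hm, fin_cyclic_induction hne fun k hk => ?_⟩
    rw [← hr.stretch_succ] at hk
    exact fun h => hk (((hCm hqC (k + 1)).stretch_eq_zero_iff (hM _)
      (hr.motions_comp hm (k + 1))).2 h)
  -- Otherwise the hinges would be implied by `G k` itself at densely many placements, and the
  -- motions from `hmot` could not stretch them.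
  have hlt : ∀ k q, rigidityRank (G k) q < M k := by
    intro k q
    by_contra hge
    push Not at hge
    have hfin := Fintype.ofFinite (W k)
    have hd := dense_le_rigidityRank (G k) (g := id) (fun u e =>
      (ContinuousLinearMap.proj (R := ℝ) (φ := fun _ : W k => E3) u).analyticAt e) ⟨q, hge⟩
    obtain ⟨e, ⟨heQC, he⟩⟩ := (hQC.inter_of_isOpen_right (dense_preimage_comp (φ k) hd)
      ((isOpen_le_rigidityRank (G k) (M k)).preimage (continuous_comp_embedding (φ k)))).nonempty
    obtain ⟨m, hm, hne⟩ := hmot e heQC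
    have heq := motions_eq_of_rank_le (G := G k)
      (G' := addHinges (G k) (a k) (b k) (c k) (d k))
      (le_sup_left.trans le_sup_left) ((hM k (e ∘ φ k)).trans he)
    have hmk := hr.motions_comp hm k
    rw [← heq, mem_motions_addHinges] at hmk
    exact hne k hmk.2.2
  have hprod : ∀ (q : V → E3) (ε : Fin n → ℤˣ),
      (∀ i, HingeGeneric (G i) (a i) (b i) (c i) (d i) (M i) (q ∘ φ i) ∧
        HasSign (G i) (a i) (b i) (c i) (d i) (ε i) (q ∘ φ i)) → ∏ i, ε i = 1 := by
    intro q ε hq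
    -- Signs are locally constant, so `q` may be moved into `Q ∩ C`, where a motion stretching all
    -- hinges exists.
    have hev : ∀ᶠ q' in 𝓝 q, ∀ i, HingeGeneric (G i) (a i) (b i) (c i) (d i) (M i) (q' ∘ φ i) ∧
        HasSign (G i) (a i) (b i) (c i) (d i) (ε i) (q' ∘ φ i) := by
      rw [Filter.eventually_all]
      intro i
      exact (continuous_comp_embedding (φ i)).continuousAt.eventually
        ((isOpen_hingeGeneric_hasSign (hr.ne_cd i) (hM i) (hlt i) (ε i)).mem_nhds (hq i))
    obtain ⟨q', hq', hs⟩ := hQC.inter_nhds_nonempty hev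
    obtain ⟨m, hm, hne⟩ := hmot q' hq'
    choose l hl hlm using fun i => (hs i).2
    have h1 := hr.prod_ratio_eq_one (fun i => hlm i _ (hr.motions_comp hm i)) hne
    have h2 : 0 < ∏ i, (((ε i : ℤ) : ℝ) * l i) := Finset.prod_pos fun i _ => hl i
    rw [Finset.prod_mul_distrib, h1, mul_one] at h2
    rcases Int.units_eq_one_or (∏ i, ε i) with h | h
    · exact h
    · exfalso
      have h3 : ∏ i, ((ε i : ℤ) : ℝ) = (((∏ i, ε i : ℤˣ) : ℤ) : ℝ) := by
        rw [Units.coe_prod]; push_cast; rfl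
      rw [h3, h] at h2
      norm_num at h2
  -- Any glued hinge-generic placement has signs of product 1, and constancy identifies its signs
  -- with those at the unglued `p₀ k`.
  obtain ⟨q, hq⟩ := hC.nonempty
  choose ε' hε' using fun k => (hCm hq k).exists_sign (hM k)
  have h1 := hprod q ε' fun k => ⟨hCm hq k, hε' k⟩
  have h2 : ε' = ε := funext fun k =>
    (hr.isSignRelation hn hM hlt h₀ hprod k).const
      (x := ((q ∘ φ k) (a k), (q ∘ φ k) (b k))) (y := ((q ∘ φ k) (c k), (q ∘ φ k) (d k)))
      (x' := (p₀ k (a k), p₀ k (b k))) (y' := (p₀ k (c k), p₀ k (d k)))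
      ⟨_, ⟨hCm hq k, hε' k⟩, ⟨rfl, rfl⟩, rfl, rfl⟩ ⟨_, ⟨h₀ k, hsign k⟩, ⟨rfl, rfl⟩, rfl, rfl⟩
  rw [h2, hε] at h1
  exact absurd h1 (by decide)

end

/-! ### From infinitesimal motions to finite flexes. -/

/-- Where the derivative has maximum rank, each vector of its kernel is tangent to a curve on which
the map is constant. -/
lemma exists_curve_of_maximal_rank {E F : Type*} [NormedAddCommGroup E] [NormedSpace ℝ E]
    [FiniteDimensional ℝ E] [NormedAddCommGroup F] [NormedSpace ℝ F] [FiniteDimensional ℝ F]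
    {f : E → F} (hf : ContDiff ℝ 1 f) {p : E}
    (hp : ∀ q, finrank ℝ (fderiv ℝ f q).toLinearMap.range ≤
      finrank ℝ (fderiv ℝ f p).toLinearMap.range) {m : E} (hm : fderiv ℝ f p m = 0) :
    ∃ γ : ℝ → E, γ 0 = p ∧ HasDerivAt γ m 0 ∧ ∀ᶠ t in 𝓝 0, f (γ t) = f p := by
  have hE := FiniteDimensional.complete ℝ E
  set R := (fderiv ℝ f p).toLinearMap.range with hR
  set K := (fderiv ℝ f p).toLinearMap.ker with hK
  obtain ⟨P₀, hP₀⟩ := LinearMap.exists_leftInverse_of_injective R.subtype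
    (LinearMap.ker_eq_bot.2 R.injective_subtype)
  obtain ⟨π₀, hπ₀⟩ := LinearMap.exists_leftInverse_of_injective K.subtype
    (LinearMap.ker_eq_bot.2 K.injective_subtype)
  let P : F →L[ℝ] R := P₀.toContinuousLinearMap
  let π : E →L[ℝ] K := π₀.toContinuousLinearMap
  have hP : ∀ x : R, P x = x := fun x => LinearMap.congr_fun hP₀ x
  have hπ : ∀ x : K, π x = x := fun x => LinearMap.congr_fun hπ₀ x
  -- `Φ` is a local diffeomorphism at `p`. The curve is the preimage of a straight line in the
  -- direction of `m` in `K`, along which `P ∘ f` is constant.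
  let Φ : E → R × K := fun q => (P (f q), π q)
  let Φ' : E → E →L[ℝ] R × K := fun q => (P.comp (fderiv ℝ f q)).prod π
  have hfd : ∀ q, HasFDerivAt f (fderiv ℝ f q) q := fun q =>
    (hf.differentiable one_ne_zero q).hasFDerivAt
  have hΦc : ContDiff ℝ 1 Φ := (P.contDiff.comp hf).prodMk π.contDiff
  have hΦd : ∀ q, HasFDerivAt Φ (Φ' q) q := fun q =>
    (P.hasFDerivAt.comp q (hfd q)).prodMk π.hasFDerivAt
  have hinj : Function.Injective (Φ' p) := by
    rw [injective_iff_map_eq_zero]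
    intro v hv
    have h1 : P (fderiv ℝ f p v) = 0 := congrArg Prod.fst hv
    have h2 : π v = 0 := congrArg Prod.snd hv
    have h3 := hP ⟨fderiv ℝ f p v, ⟨v, rfl⟩⟩
    rw [h1] at h3
    have h4 : fderiv ℝ f p v = 0 := (congrArg Subtype.val h3).symm
    have h5 := hπ ⟨v, h4⟩
    rw [h2] at h5
    exact (congrArg Subtype.val h5).symm
  have hrn : finrank ℝ R + finrank ℝ K = finrank ℝ E :=
    LinearMap.finrank_range_add_finrank_ker (fderiv ℝ f p).toLinearMap
  let e : E ≃L[ℝ] R × K := (LinearEquiv.ofInjectiveOfFinrankEq (Φ' p).toLinearMap hinj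
    (by rw [finrank_prod, hrn])).toContinuousLinearEquiv
  have he : (e : E →L[ℝ] R × K) = Φ' p := by ext1 v; rfl
  have hs : HasStrictFDerivAt Φ (e : E →L[ℝ] R × K) p :=
    hΦc.contDiffAt.hasStrictFDerivAt' (he ▸ hΦd p) one_ne_zero
  have hsc := hΦc.contDiffAt.to_localInverse (a := p) (f' := e) (he ▸ hΦd p) one_ne_zero
  set Ψ : R × K → E := hs.localInverse Φ e p with hΨ
  have hΨc : ContDiffAt ℝ 1 Ψ (Φ p) := hsc
  have hΨ0 : Ψ (Φ p) = p := hs.localInverse_apply_image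
  have hΨr : ∀ᶠ y in 𝓝 (Φ p), Φ (Ψ y) = y := hs.eventually_right_inverse
  have hΨd : HasFDerivAt Ψ (e.symm : R × K →L[ℝ] E) (Φ p) := hs.to_localInverse.hasFDerivAt
  let mK : K := ⟨m, hm⟩
  let y : ℝ → R × K := fun t => Φ p + t • ((0 : R), mK)
  have hy0 : y 0 = Φ p := by simp [y]
  have hyd : ∀ t, HasDerivAt y ((0 : R), mK) t := fun t => by
    have h := ((hasDerivAt_id t).smul_const ((0 : R), mK)).const_add (Φ p)
    rw [one_smul] at h
    exact h
  have hyc : ContinuousAt y 0 := (hyd 0).continuousAt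
  have hyt : Filter.Tendsto y (𝓝 0) (𝓝 (Φ p)) := hy0 ▸ hyc
  have hesymm : e.symm ((0 : R), mK) = m := by
    rw [ContinuousLinearEquiv.symm_apply_eq]
    change _ = Φ' p m
    refine Prod.ext ?_ ?_
    · change (0 : R) = P (fderiv ℝ f p m)
      rw [hm, map_zero]
    · exact (hπ mK).symm
  refine ⟨fun t => Ψ (y t), ?_, ?_, ?_⟩
  · change Ψ (y 0) = p
    rw [hy0, hΨ0]
  · have := HasFDerivAt.comp_hasDerivAt (0 : ℝ) (by rw [hy0]; exact hΨd) (hyd 0)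
    have h2 : (e.symm : R × K →L[ℝ] E) ((0 : R), mK) = m := hesymm
    rw [h2] at this
    exact this
  -- near `p`, the kernel of the derivative has constant dimension
  have hker : ∀ᶠ q in 𝓝 p, ∀ v, P (fderiv ℝ f q v) = 0 → fderiv ℝ f q v = 0 := by
    have hc : Continuous Φ' := by
      have h1 : Continuous fun q => fderiv ℝ f q := hf.continuous_fderiv one_ne_zero
      exact (ContinuousLinearMap.prodₗᵢ ℝ).continuous.comp
        ((continuous_const.clm_comp h1).prodMk continuous_const)
    have h1 : ∀ᶠ q in 𝓝 p, Φ' q ∈ Set.range ((↑) : (E ≃L[ℝ] R × K) → E →L[ℝ] R × K) :=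
      hc.continuousAt.eventually (he ▸ ContinuousLinearEquiv.nhds e)
    filter_upwards [h1] with q hq v hv
    obtain ⟨eq, heq⟩ := hq
    set A := (fderiv ℝ f q).toLinearMap.ker
    set B := (P.comp (fderiv ℝ f q)).toLinearMap.ker
    have hAB : A ≤ B := fun w hw => by
      change P (fderiv ℝ f q w) = 0
      have : fderiv ℝ f q w = 0 := hw
      rw [this, map_zero]
    -- `Φ' q` is injective, so `π` embeds `B` in `K`; maximality of the rank at `p` bounds `A` from
    -- below by the dimension of `K`. Hence `A = B`.
    have hBK : finrank ℝ B ≤ finrank ℝ K := by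
      refine LinearMap.finrank_le_finrank_of_injective (f := π.toLinearMap.comp B.subtype) ?_
      rw [injective_iff_map_eq_zero]
      intro w hw
      have : Φ' q w = 0 := Prod.ext w.2 hw
      rw [← heq] at this
      ext1
      exact (map_eq_zero_iff _ eq.injective).1 this
    have hKA : finrank ℝ K ≤ finrank ℝ A := by
      have h2 : _ + finrank ℝ A = _ :=
        LinearMap.finrank_range_add_finrank_ker (fderiv ℝ f q).toLinearMap
      have h3 := hp q
      omega
    have : A = B := Submodule.eq_of_le_of_finrank_le hAB (hBK.trans hKA)
    have hvB : v ∈ B := hv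
    rw [← this] at hvB
    exact hvB
  have hΨcont : ContinuousAt Ψ (Φ p) := hΨc.continuousAt
  have hΨt : Filter.Tendsto Ψ (𝓝 (Φ p)) (𝓝 p) := by
    have := hΨcont.tendsto
    rwa [hΨ0] at this
  have hΨdiff : ∀ᶠ z in 𝓝 (Φ p), DifferentiableAt ℝ Ψ z := by
    filter_upwards [hΨc.eventually (by simp)] with z hz
    exact hz.differentiableAt one_ne_zero
  have hall : ∀ᶠ z in 𝓝 (Φ p), (∀ v, P (fderiv ℝ f (Ψ z) v) = 0 → fderiv ℝ f (Ψ z) v = 0) ∧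
      DifferentiableAt ℝ Ψ z ∧ ∀ᶠ z' in 𝓝 z, Φ (Ψ z') = z' :=
    (hΨt.eventually hker).and (hΨdiff.and hΨr.eventually_nhds)
  have hzero : ∀ᶠ t in 𝓝 (0 : ℝ), HasDerivAt (fun t => f (Ψ (y t))) 0 t := by
    filter_upwards [hyt.eventually hall] with t ht
    obtain ⟨h1, h2, h3⟩ := ht
    have hγ : HasDerivAt (fun t => Ψ (y t)) (fderiv ℝ Ψ (y t) ((0 : R), mK)) t :=
      h2.hasFDerivAt.comp_hasDerivAt t (hyd t)
    have hfγ := (hfd (Ψ (y t))).comp_hasDerivAt t hγ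
    have hPγ := P.hasFDerivAt.comp_hasDerivAt t hfγ
    have hconst : (fun t => P (f (Ψ (y t)))) =ᶠ[𝓝 t] fun _ => P (f p) := by
      filter_upwards [(hyd t).continuousAt.eventually h3] with t' ht'
      have h4 : P (f (Ψ (y t'))) = (y t').1 := congrArg Prod.fst ht'
      rw [h4]
      simp [y, Φ]
    -- The derivative of `P ∘ f` along the curve vanishes, and by `hker` so does that of `f`.
    have hP0 := hPγ.unique ((hasDerivAt_const t (P (f p))).congr_of_eventuallyEq hconst)
    have := h1 _ hP0
    rw [← this]
    exact hfγ
  obtain ⟨δ, hδ, hball⟩ := Metric.eventually_nhds_iff_ball.1 hzero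
  filter_upwards [Metric.ball_mem_nhds (0 : ℝ) hδ] with t ht
  have hconst := (convex_ball (0 : ℝ) δ).is_const_of_fderivWithin_eq_zero (𝕜 := ℝ)
    (f := fun t => f (Ψ (y t)))
    (fun t ht => (hball t ht).differentiableAt.differentiableWithinAt)
    (fun t ht => by
      rw [fderivWithin_of_isOpen Metric.isOpen_ball ht, (hball t ht).hasFDerivAt.fderiv]
      ext; simp) ht (Metric.mem_ball_self hδ)
  rw [hconst, hy0, hΨ0]

section
variable {V : Type*} [Finite V] {G : SimpleGraph V} {p : V → E3}

/-- An infinitesimal motion of a generic framework extends to a finite flex. -/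
lemma IsGeneric.exists_flex (hp : IsGeneric G p) {m : V → E3} (hm : m ∈ motions G p) :
    ∃ γ : ℝ → V → E3, γ 0 = p ∧ HasDerivAt γ m 0 ∧
      ∀ᶠ t in 𝓝 0, ∀ u v, G.Adj u v → dist (γ t u) (γ t v) = dist (p u) (p v) := by
  have := Fintype.ofFinite V
  have := Fintype.ofFinite {e : V × V // G.Adj e.1 e.2}
  let f : (V → E3) → {e : V × V // G.Adj e.1 e.2} → ℝ := fun q e =>
    inner ℝ (q e.1.1 - q e.1.2) (q e.1.1 - q e.1.2)
  have hf : ContDiff ℝ 1 f := by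
    rw [contDiff_pi]
    intro e
    have h1 : ContDiff ℝ 1 fun q : V → E3 => q e.1.1 - q e.1.2 :=
      (contDiff_apply ℝ E3 e.1.1).sub (contDiff_apply ℝ E3 e.1.2)
    exact h1.inner ℝ h1
  have hd : ∀ q w e, fderiv ℝ f q w e = 2 * stretch q w e.1.1 e.1.2 := by
    intro q w e
    have h1 : HasFDerivAt (fun q : V → E3 => q e.1.1 - q e.1.2)
        (ContinuousLinearMap.proj (R := ℝ) (φ := fun _ : V => E3) e.1.1 -
          ContinuousLinearMap.proj (R := ℝ) (φ := fun _ : V => E3) e.1.2) q :=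
      (hasFDerivAt_apply e.1.1 q).sub (hasFDerivAt_apply e.1.2 q)
    have h2 := h1.inner ℝ h1
    have h3 := (hasFDerivAt_pi'.1 (hf.differentiable one_ne_zero q).hasFDerivAt e)
    have h4 := congrArg (fun L => L w) (h3.unique h2)
    simp only [ContinuousLinearMap.comp_apply, ContinuousLinearMap.proj_apply] at h4
    rw [h4]
    simp only [ContinuousLinearMap.prod_apply, fderivInnerCLM_apply, sub_apply,
      ContinuousLinearMap.proj_apply, stretch]
    rw [real_inner_comm (q e.1.1 - q e.1.2)]
    ring
  have hker : ∀ q, (fderiv ℝ f q).toLinearMap.ker = motions G q := by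
    intro q
    ext w
    rw [LinearMap.mem_ker, mem_motions]
    constructor
    · intro h u v huv
      have := congrFun h ⟨(u, v), huv⟩
      have h2 := hd q w ⟨(u, v), huv⟩
      rw [ContinuousLinearMap.coe_coe] at this
      rw [this] at h2
      simpa using h2.symm
    · intro h
      funext e
      rw [ContinuousLinearMap.coe_coe, hd, h _ _ e.2]
      simp
  have hrank : ∀ q, finrank ℝ (fderiv ℝ f q).toLinearMap.range = rigidityRank G q := by
    intro q
    have h1 := LinearMap.finrank_range_add_finrank_ker (fderiv ℝ f q).toLinearMap
    have h2 := rigidityRank_add_finrank_motions G q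
    rw [hker] at h1
    have h3 : finrank ℝ (V → E3) = 3 * Fintype.card V := by
      rw [Module.finrank_pi_fintype]; simp [mul_comm]
    omega
  have hm' : m ∈ (fderiv ℝ f p).toLinearMap.ker := by rw [hker]; exact hm
  obtain ⟨γ, h0, hγ, hc⟩ := exists_curve_of_maximal_rank hf
    (fun q => by rw [hrank, hrank]; exact hp q) (m := m) hm'
  refine ⟨γ, h0, hγ, hc.mono fun t ht u v huv => ?_⟩
  have := congrFun ht ⟨(u, v), huv⟩
  simp only [f, real_inner_self_eq_norm_sq] at this
  rw [dist_eq_norm, dist_eq_norm]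
  exact (sq_eq_sq₀ (norm_nonneg _) (norm_nonneg _)).1 this

/-- The motions of a rigid generic framework respect all distances and all affine dependencies. -/
lemma IsGeneric.motions_of_rigid [Fintype V] (hp : IsGeneric G p) (hr : IsRigidFramework G p)
    {m : V → E3} (hm : m ∈ motions G p) :
    (∀ u v, stretch p m u v = 0) ∧
      ∀ c : V → ℝ, ∑ v, c v = 0 → ∑ v, c v • p v = 0 → ∑ v, c v • m v = 0 := by
  obtain ⟨γ, h0, hγ, hc⟩ := hp.exists_flex hm
  have hγt : Filter.Tendsto γ (𝓝 0) (𝓝 p) := h0 ▸ hγ.continuousAt.tendsto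
  have hdist : ∀ᶠ t in 𝓝 0, ∀ u v, dist (γ t u) (γ t v) = dist (p u) (p v) := by
    filter_upwards [hγt.eventually hr, hc] with t h1 h2
    intro u v
    exact (h1 h2).dist_eq u v
  have hγv : ∀ v, HasDerivAt (fun t => γ t v) (m v) 0 := fun v => hasDerivAt_pi.1 hγ v
  constructor
  · intro u v
    have h1 := (hγv u).sub (hγv v)
    have h2 := h1.inner ℝ h1
    have h3 : (fun t => inner ℝ (γ t u - γ t v) (γ t u - γ t v)) =ᶠ[𝓝 0]
        fun _ => inner ℝ (p u - p v) (p u - p v) := by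
      filter_upwards [hdist] with t ht
      rw [real_inner_self_eq_norm_sq, real_inner_self_eq_norm_sq, ← dist_eq_norm, ← dist_eq_norm,
        ht u v]
    have h4 := h2.unique ((hasDerivAt_const (0 : ℝ) _).congr_of_eventuallyEq h3)
    simp only [h0, Pi.sub_apply] at h4
    rw [real_inner_comm (p u - p v)] at h4
    unfold stretch
    linarith
  · intro c hc0 hcp
    -- With weights of sum zero, the squared norm of the combination depends on distances only. The
    -- dependency therefore survives along the flex and can be differentiated.
    have key : ∀ q : V → E3, inner ℝ (∑ v, c v • q v) (∑ v, c v • q v) =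
        (-∑ u, ∑ v, c u * c v * (dist (q u) (q v) * dist (q u) (q v))) / 2 := by
      intro q
      have := EuclideanGeometry.inner_weightedVSub (s₁ := Finset.univ) (w₁ := c) q hc0
        (s₂ := Finset.univ) (w₂ := c) q hc0
      rwa [Finset.weightedVSub_eq_linear_combination _ hc0] at this
    have hzero : (fun t => ∑ v, c v • γ t v) =ᶠ[𝓝 0] fun _ => 0 := by
      filter_upwards [hdist] with t ht
      have h1 := key (γ t)
      simp only [ht] at h1
      rw [← key p, hcp, inner_zero_left] at h1
      exact inner_self_eq_zero.1 h1
    have hd : HasDerivAt (fun t => ∑ v, c v • γ t v) (∑ v, c v • m v) 0 :=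
      HasDerivAt.fun_sum fun v _ => (hγv v).const_smul (c v)
    exact hd.unique ((hasDerivAt_const (0 : ℝ) _).congr_of_eventuallyEq hzero)

end

/-! ### Rigid velocity fields -/

/-- The cross product on Euclidean 3-space. -/
noncomputable def cross (x y : E3) : E3 :=
  !₂[x 1 * y 2 - x 2 * y 1, x 2 * y 0 - x 0 * y 2, x 0 * y 1 - x 1 * y 0]

lemma inner_eq (x y : E3) : inner ℝ x y = x 0 * y 0 + x 1 * y 1 + x 2 * y 2 := by
  simp only [PiLp.inner_apply, Fin.sum_univ_three, RCLike.inner_apply, conj_trivial]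
  ring

/-- The velocity field of a rigid motion, with angular velocity `ξ.1`, as a linear function of its
parameters. -/
noncomputable def rigidVelocity (x : E3) : (E3 × E3) →ₗ[ℝ] E3 where
  toFun ξ := cross ξ.1 x + ξ.2
  map_add' ξ ξ' := by
    ext k; fin_cases k <;> simp [cross] <;> ring
  map_smul' r ξ := by
    ext k; fin_cases k <;> simp [cross] <;> ring

lemma rigidVelocity_apply (x : E3) (ξ : E3 × E3) : rigidVelocity x ξ = cross ξ.1 x + ξ.2 := rfl

lemma inner_sub_rigidVelocity_sub (ξ : E3 × E3) (x y : E3) :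
    inner ℝ (x - y) (rigidVelocity x ξ - rigidVelocity y ξ) = 0 := by
  rw [inner_eq]
  simp [rigidVelocity_apply, cross]
  ring

/-- The triple product of the vectors from `o` to `x`, `y`, `z`. -/
noncomputable def triple (o x y z : E3) : ℝ := inner ℝ (x - o) (cross (y - o) (z - o))

/-- Cramer's rule, with the coefficients arranged so that they vanish once `cross w` kills the three
edge vectors. -/
lemma triple_smul_eq (o x y z w : E3) : triple o x y z • w =
    inner ℝ (cross w (y - o)) (z - o) • (x - o) + inner ℝ (cross w (z - o)) (x - o) • (y - o)
      + inner ℝ (cross w (x - o)) (y - o) • (z - o) := by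
  ext k
  fin_cases k <;> simp [triple, cross, inner_eq] <;> ring

lemma cross_sub (w x y : E3) : cross w (x - y) = cross w x - cross w y := by
  ext k; fin_cases k <;> simp [cross] <;> ring

lemma eq_zero_of_rigidVelocity_eq_zero {o x y z : E3} (h : triple o x y z ≠ 0) {ξ : E3 × E3}
    (ho : rigidVelocity o ξ = 0) (hx : rigidVelocity x ξ = 0) (hy : rigidVelocity y ξ = 0)
    (hz : rigidVelocity z ξ = 0) : ξ = 0 := by
  have key : ∀ v, rigidVelocity v ξ = 0 → cross ξ.1 (v - o) = 0 := fun v hv => by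
    rw [rigidVelocity_apply] at hv ho
    rw [cross_sub, eq_neg_of_add_eq_zero_left hv, eq_neg_of_add_eq_zero_left ho, sub_self]
  have h1 := triple_smul_eq o x y z ξ.1
  rw [key x hx, key y hy, key z hz] at h1
  simp only [inner_zero_left, zero_smul, add_zero] at h1
  have h2 : ξ.1 = 0 := (smul_eq_zero.1 h1).resolve_left h
  rw [rigidVelocity_apply, h2] at ho
  have h3 : cross 0 o = 0 := by ext k; fin_cases k <;> simp [cross]
  rw [h3, zero_add] at ho
  exact Prod.ext h2 ho

/-- The rigid motion that rotates about the line through `x` and `y`. -/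
noncomputable def axisRotation (x y : E3) : E3 × E3 := (y - x, -cross (y - x) x)

lemma rigidVelocity_axisRotation (x y v : E3) :
    rigidVelocity v (axisRotation x y) = cross (y - x) (v - x) := by
  rw [rigidVelocity_apply, axisRotation, cross_sub]
  exact (sub_eq_add_neg _ _).symm

lemma rigidVelocity_axisRotation_left (x y : E3) : rigidVelocity x (axisRotation x y) = 0 := by
  rw [rigidVelocity_axisRotation]; ext k; fin_cases k <;> simp [cross]

lemma rigidVelocity_axisRotation_right (x y : E3) : rigidVelocity y (axisRotation x y) = 0 := by
  rw [rigidVelocity_axisRotation]; ext k; fin_cases k <;> simp [cross] <;> ring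

/-- Rotating `z` about the line through `o` and `y` while `x` stays fixed changes the distance of
`x` and `z`, unless the four points are coplanar. -/
lemma inner_sub_axisRotation (o x y z : E3) :
    inner ℝ (x - z) (0 - rigidVelocity z (axisRotation o y)) = - triple o x y z := by
  rw [rigidVelocity_axisRotation, triple, inner_eq, inner_eq]
  simp [cross]
  ring

lemma rigidVelocity_axisRotation_ne_zero {o x y z : E3} (h : triple o x y z ≠ 0) :
    rigidVelocity z (axisRotation o y) ≠ 0 := by
  intro h0
  rw [rigidVelocity_axisRotation] at h0
  exact h (by rw [triple, h0, inner_zero_right])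

/-! ### Dimension of the space of motions of a rigid framework -/

section
variable {V : Type*} [Fintype V] {G : SimpleGraph V} {p : V → E3}

omit [Fintype V] in
-- Relative to `o`, zero stretches make `ev` skew. With three independent vectors `p (u i) - p o`,
-- the motion is determined by `m o` and three entries: 3 + 3 parameters.
lemma finrank_le_six_of_stretch_eq_zero {S : Submodule ℝ (V → E3)}
    (hS : ∀ m ∈ S, ∀ u v, stretch p m u v = 0) (o : V)
    (hp : ∀ x : E3, (∀ v, inner ℝ (p v - p o) x = 0) → x = 0) : finrank ℝ S ≤ 6 := by
  have hspan : Submodule.span ℝ (Set.range fun v => p v - p o) = ⊤ := by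
    rw [← Submodule.orthogonal_eq_bot_iff, Submodule.eq_bot_iff]
    intro x hx
    refine hp x fun v => ?_
    exact (Submodule.mem_orthogonal _ _).1 hx _ (Submodule.subset_span ⟨v, rfl⟩)
  obtain ⟨f, hf, hfs, -⟩ :=
    Submodule.exists_fun_fin_finrank_span_eq ℝ (Set.range fun v => p v - p o)
  have h3 : finrank ℝ (Submodule.span ℝ (Set.range fun v => p v - p o)) = 3 := by
    rw [hspan, finrank_top]; simp
  replace hfs := hfs.trans hspan
  generalize finrank ℝ (Submodule.span ℝ (Set.range fun v => p v - p o)) = r at h3 f hf hfs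
  subst h3
  choose u hu using hf
  have hperp : ∀ x : E3, (∀ i, inner ℝ (p (u i) - p o) x = 0) → x = 0 := by
    intro x hx
    have : x ∈ (Submodule.span ℝ (Set.range f))ᗮ := by
      rw [Submodule.mem_orthogonal]
      intro y hy
      induction hy using Submodule.span_induction with
      | mem y hy => obtain ⟨i, rfl⟩ := hy; rw [← hu]; exact hx i
      | zero => simp
      | add y z _ _ hy hz => rw [inner_add_left, hy, hz, add_zero]
      | smul c y _ hy => rw [inner_smul_left, hy, mul_zero]
    rw [hfs, Submodule.top_orthogonal_eq_bot] at this
    exact this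
  let ev : V → V → (V → E3) →ₗ[ℝ] ℝ := fun v w =>
    (innerₛₗ ℝ (p v - p o)).comp
      ((LinearMap.proj w : (V → E3) →ₗ[ℝ] E3) - (LinearMap.proj o : (V → E3) →ₗ[ℝ] E3))
  have hev : ∀ v w m, ev v w m = inner ℝ (p v - p o) (m w - m o) := fun v w m => by
    simp only [ev, LinearMap.comp_apply, LinearMap.sub_apply, LinearMap.proj_apply,
      innerₛₗ_apply_apply]
  let T : (V → E3) →ₗ[ℝ] E3 × (Fin 3 → ℝ) :=
    (LinearMap.proj o : (V → E3) →ₗ[ℝ] E3).prod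
      (LinearMap.pi ![ev (u 0) (u 1), ev (u 0) (u 2), ev (u 1) (u 2)])
  have hinj : Function.Injective (T.comp S.subtype) := by
    rw [injective_iff_map_eq_zero]
    rintro ⟨m, hm⟩ hTm
    have ho : m o = 0 := congrArg Prod.fst hTm
    have h01 : ev (u 0) (u 1) m = 0 := congrFun (congrArg Prod.snd hTm) 0
    have h02 : ev (u 0) (u 2) m = 0 := congrFun (congrArg Prod.snd hTm) 1
    have h12 : ev (u 1) (u 2) m = 0 := congrFun (congrArg Prod.snd hTm) 2
    have hskew : ∀ v w, ev v w m = - ev w v m := by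
      intro v w
      have h1 := hS m hm v w
      have h2 := hS m hm v o
      have h3 := hS m hm w o
      rw [hev, hev]
      unfold stretch at h1 h2 h3
      have e1 : p v - p w = (p v - p o) - (p w - p o) := by abel
      have e2 : m v - m w = (m v - m o) - (m w - m o) := by abel
      rw [e1, e2, inner_sub_left, inner_sub_right (p v - p o) (m v - m o),
        inner_sub_right (p w - p o) (m v - m o), h2, h3] at h1
      linarith
    have hself : ∀ v, ev v v m = 0 := fun v => by
      have := hskew v v; linarith
    have hall : ∀ i j, ev (u i) (u j) m = 0 := by
      intro i j
      fin_cases i <;> fin_cases j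
      · exact hself _
      · exact h01
      · exact h02
      · rw [hskew]; exact neg_eq_zero.2 h01
      · exact hself _
      · exact h12
      · rw [hskew]; exact neg_eq_zero.2 h02
      · rw [hskew]; exact neg_eq_zero.2 h12
      · exact hself _
    have hmu : ∀ j, m (u j) - m o = 0 := fun j =>
      hperp _ fun i => by rw [← hev]; exact hall i j
    have hmv : ∀ v, m v - m o = 0 := fun v => hperp _ fun i => by
      rw [← hev, hskew, hev, hmu, inner_zero_right, neg_zero]
    ext1
    funext v
    have := hmv v
    rwa [ho, sub_zero] at this
  have := LinearMap.finrank_le_finrank_of_injective hinj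
  simpa using this

/-- Rigid generic frameworks on at least five vertices only have a six-dimensional space of
motions, and so do all other generic frameworks of the graph. -/
lemma IsRigid.finrank_motions_le (hG : IsRigid G) (hV : 5 ≤ Fintype.card V) {q : V → E3}
    (hq : IsGeneric G q) : finrank ℝ (motions G q) ≤ 6 := by
  obtain ⟨p, hp, hr⟩ := hG
  have hpq : finrank ℝ (motions G q) = finrank ℝ (motions G p) := by
    have h1 := rigidityRank_add_finrank_motions G q
    have h2 := rigidityRank_add_finrank_motions G p
    have h3 := hp q
    have h4 := hq p
    omega
  rw [hpq]
  have : Nonempty V := Fintype.card_pos_iff.1 (by omega)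
  obtain ⟨o⟩ := this
  refine finrank_le_six_of_stretch_eq_zero (p := p)
    (fun m hm => (hp.motions_of_rigid hr hm).1) o fun x hx => ?_
  -- An affine dependence `c` exists since five exceeds the dimension 4 of the target.
  let D : (V → ℝ) →ₗ[ℝ] ℝ × E3 :=
    (Fintype.linearCombination ℝ (fun _ : V => (1 : ℝ))).prod (Fintype.linearCombination ℝ p)
  have hD : D.ker ≠ ⊥ := LinearMap.ker_ne_bot_of_finrank_lt (by simp; omega)
  obtain ⟨c, hc, hc0⟩ := Submodule.exists_mem_ne_zero_of_ne_bot hD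
  have hc1 : ∑ v, c v = 0 := by
    have := congrArg Prod.fst (LinearMap.mem_ker.1 hc)
    simpa [D, Fintype.linearCombination_apply] using this
  have hc2 : ∑ v, c v • p v = 0 := by
    have := congrArg Prod.snd (LinearMap.mem_ker.1 hc)
    simpa [D, Fintype.linearCombination_apply] using this
  -- If `p` were contained in a plane with normal `x`, moving each `v` by `c v • x` would be a
  -- motion. Respecting the dependence `c` forces `∑ (c v)² • x = 0`.
  have hm : (fun v => c v • x) ∈ motions G p := by
    intro u v _
    have : p u - p v = (p u - p o) - (p v - p o) := by abel
    rw [← sub_smul, inner_smul_right, this, inner_sub_left, hx, hx, sub_zero, mul_zero]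
  have h1 := (hp.motions_of_rigid hr hm).2 c hc1 hc2
  simp only [smul_smul, ← Finset.sum_smul] at h1
  refine (smul_eq_zero.1 h1).resolve_left fun h2 => hc0 (funext fun v => ?_)
  have := (Finset.sum_eq_zero_iff_of_nonneg fun v _ => mul_self_nonneg (c v)).1 h2 v
    (Finset.mem_univ v)
  exact mul_self_eq_zero.1 this

/-- Four non-coplanar points make the rigid velocity fields a six-dimensional space of motions,
leaving room for no others. -/
lemma stretch_eq_zero_of_finrank_le (h6 : finrank ℝ (motions G p) ≤ 6) {o x y z : V}
    (ht : triple (p o) (p x) (p y) (p z) ≠ 0) {m : V → E3} (hm : m ∈ motions G p) (u v : V) :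
    stretch p m u v = 0 := by
  let Ψ : (E3 × E3) →ₗ[ℝ] (V → E3) := LinearMap.pi fun v => rigidVelocity (p v)
  have hinj : Function.Injective Ψ := by
    rw [injective_iff_map_eq_zero]
    intro ξ hξ
    exact eq_zero_of_rigidVelocity_eq_zero ht (congrFun hξ o) (congrFun hξ x) (congrFun hξ y)
      (congrFun hξ z)
  have hle : Ψ.range ≤ motions G p := by
    rintro _ ⟨ξ, rfl⟩ u v _
    exact inner_sub_rigidVelocity_sub ξ (p u) (p v)
  have heq : Ψ.range = motions G p := by
    refine Submodule.eq_of_le_of_finrank_le hle (h6.trans ?_)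
    rw [LinearMap.finrank_range_of_inj hinj]
    simp
  rw [← heq] at hm
  obtain ⟨ξ, rfl⟩ := hm
  exact inner_sub_rigidVelocity_sub ξ (p u) (p v)

end

/-! ### General position -/

/-- Finitely many dense open conditions hold together. `q` is defined on all of `V` because hinge
vertices outside the subgraph serve as points of rotation axes. -/
lemma exists_generic_general_position {V : Type*} [Finite V] {s : Set V} {H : SimpleGraph s}
    {p : s → E3} (hp : IsGeneric H p) :
    ∃ q : V → E3, IsGeneric H (fun v => q v) ∧ ∀ o x y z : V, o ≠ x → o ≠ y → o ≠ z → x ≠ y →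
      x ≠ z → y ≠ z → triple (q o) (q x) (q y) (q z) ≠ 0 := by
  classical
  have := Fintype.ofFinite V
  have := Fintype.ofFinite s
  let f : V × V × V × V → (V → E3) → ℝ := fun e q =>
    triple (q e.1) (q e.2.1) (q e.2.2.1) (q e.2.2.2)
  let P : V × V × V × V → Prop := fun e => e.1 ≠ e.2.1 ∧ e.1 ≠ e.2.2.1 ∧ e.1 ≠ e.2.2.2 ∧
    e.2.1 ≠ e.2.2.1 ∧ e.2.1 ≠ e.2.2.2 ∧ e.2.2.1 ≠ e.2.2.2
  have hf : ∀ e, AnalyticOnNhd ℝ (f e) Set.univ := by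
    intro e q _
    have hc : ∀ (v : V) (k : Fin 3), AnalyticAt ℝ (fun q : V → E3 => q v k) q := fun v k =>
      ((EuclideanSpace.proj k : E3 →L[ℝ] ℝ).comp
        (ContinuousLinearMap.proj (R := ℝ) (φ := fun _ : V => E3) v)).analyticAt q
    simp only [f, triple, inner_eq, cross, PiLp.sub_apply, Matrix.cons_val]
    fun_prop
  have hdense : ∀ e : {e // P e}, Dense {q | f e q ≠ 0} := by
    rintro ⟨⟨o, x, y, z⟩, h1, h2, h3, h4, h5, h6⟩
    simp only at h1 h2 h3 h4 h5 h6
    let q₀ : V → E3 := fun v => if v = x then !₂[1, 0, 0] else if v = y then !₂[0, 1, 0] else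
      if v = z then !₂[0, 0, 1] else 0
    refine dense_ne_zero_of_analytic (hf _) (e₀ := q₀) ?_
    have e1 : q₀ o = 0 := by simp [q₀, h1, h2, h3]
    have e2 : q₀ x = !₂[1, 0, 0] := by simp [q₀]
    have e3 : q₀ y = !₂[0, 1, 0] := by simp [q₀, h4.symm]
    have e4 : q₀ z = !₂[0, 0, 1] := by simp [q₀, h5.symm, h6.symm]
    simp [f, e1, e2, e3, e4, triple, cross, inner_eq]
  have hopen : ∀ e : {e // P e}, IsOpen {q | f e q ≠ 0} := fun e =>
    isOpen_ne_fun (continuousOn_univ.1 (hf e).continuousOn) continuous_const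
  have hrank := dense_preimage_comp (Function.Embedding.subtype (· ∈ s))
    (dense_le_rigidityRank H (g := id) (fun u e =>
      (ContinuousLinearMap.proj (R := ℝ) (φ := fun _ : s => E3) u).analyticAt e) ⟨p, le_refl _⟩)
  obtain ⟨q, hq1, hq2⟩ := (hrank.inter_of_isOpen_left (dense_iInter_of_isOpen hopen hdense)
    ((isOpen_le_rigidityRank H _).preimage (continuous_comp_embedding _))).nonempty
  refine ⟨q, fun q' => (hp q').trans hq1, fun o x y z h1 h2 h3 h4 h5 h6 => ?_⟩
  exact Set.mem_iInter.1 hq2 ⟨(o, x, y, z), h1, h2, h3, h4, h5, h6⟩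

/-! ### Transport along isomorphisms -/

section
variable {V V' : Type*} [Finite V] [Finite V'] {G : SimpleGraph V} {G' : SimpleGraph V'}

lemma rigidityRank_comp_iso (e : G ≃g G') (p : V' → E3) :
    rigidityRank G (p ∘ e) = rigidityRank G' p := by
  have := Fintype.ofFinite V
  have := Fintype.ofFinite V'
  have h1 := rigidityRank_add_finrank_motions G (p ∘ e)
  have h2 := rigidityRank_add_finrank_motions G' p
  have h3 : motions G (p ∘ e)
      = (motions G' p).map (LinearEquiv.funCongrLeft ℝ E3 e.toEquiv).toLinearMap := by
    ext m
    rw [Submodule.mem_map]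
    constructor
    · intro hm
      refine ⟨m ∘ e.symm, fun u v huv => ?_, funext fun v => ?_⟩
      · have h := hm (e.symm u) (e.symm v) (e.symm.map_adj_iff.2 huv)
        simpa using h
      · simp [LinearEquiv.funCongrLeft_apply, LinearMap.funLeft_apply]
    · rintro ⟨m, hm, rfl⟩ u v huv
      exact hm _ _ (e.map_adj_iff.2 huv)
  rw [h3, LinearEquiv.finrank_map_eq, Fintype.card_congr e.toEquiv] at h1
  omega

lemma IsRigid.of_iso (e : G ≃g G') (h : IsRigid G') : IsRigid G := by
  obtain ⟨p, hp, hr⟩ := h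
  have hcancel : ∀ q : V → E3, (q ∘ e.symm) ∘ e = q := fun q => by
    ext v; simp
  refine ⟨p ∘ e, fun q => ?_, ?_⟩
  · rw [rigidityRank_comp_iso, ← hcancel q, rigidityRank_comp_iso]
    exact hp _
  · have hc : Continuous fun q : V → E3 => q ∘ e.symm := by unfold Function.comp; fun_prop
    have ht : Filter.Tendsto (fun q : V → E3 => q ∘ e.symm) (𝓝 (p ∘ e)) (𝓝 p) := by
      have := hc.tendsto (p ∘ e)
      have h2 : (p ∘ e) ∘ e.symm = p := by ext v; simp
      rwa [h2] at this
    filter_upwards [ht.eventually hr] with q hq hd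
    have := hq fun u v huv => by
      have := hd (e.symm u) (e.symm v) (e.symm.map_adj_iff.2 huv)
      simpa using this
    intro u v
    have := this (e u) (e v)
    simpa using this

end

/-! ### Counting degrees of freedom around a ring -/

/-- Chains of parameters `ξ k` with `ξ k - ξ (k + 1) ∈ B k` have at least `n` degrees of freedom
beyond those in `A k`, if `A k` is properly contained in `B k`. -/
lemma le_finrank_map_of_cyclic {n : ℕ} [NeZero n] {E F : Type*} [AddCommGroup E] [Module ℝ E]
    [FiniteDimensional ℝ E] [AddCommGroup F] [Module ℝ F] {A B : Fin n → Submodule ℝ E}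
    (hAB : ∀ k, A k < B k) (L : (Fin n → E) →ₗ[ℝ] F) (C : Submodule ℝ (Fin n → E))
    (hC : ∀ ξ, ξ ∈ C ↔ ∀ k, ξ k - ξ (k + 1) ∈ B k)
    (hL : ∀ ξ ∈ C, L ξ = 0 → ∀ k, ξ k ∈ A k) : n ≤ finrank ℝ (C.map L) := by
  let D : (Fin n → E) →ₗ[ℝ] (∀ k, E ⧸ B k) :=
    LinearMap.pi fun k => (B k).mkQ.comp
      ((LinearMap.proj k : (Fin n → E) →ₗ[ℝ] E) - LinearMap.proj (k + 1))
  have hker : D.ker = C := by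
    ext ξ
    rw [LinearMap.mem_ker, hC, funext_iff]
    refine forall_congr' fun k => ?_
    simp only [D, LinearMap.pi_apply, LinearMap.comp_apply, LinearMap.sub_apply,
      LinearMap.proj_apply, Pi.zero_apply, Submodule.mkQ_apply, Submodule.Quotient.mk_eq_zero]
  have h1 := LinearMap.finrank_range_add_finrank_ker D
  -- As the kernel of `D`, `C` has dimension at least that of the product of the `B k`; the kernel
  -- of `L` on `C` embeds in the product of the `A k`.
  have h2 : finrank ℝ D.range ≤ ∑ k, finrank ℝ (E ⧸ B k) := by
    rw [← Module.finrank_pi_fintype]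
    exact Submodule.finrank_le _
  have h3 : finrank ℝ (Fin n → E) = ∑ k, (finrank ℝ (E ⧸ B k) + finrank ℝ (B k)) := by
    rw [Module.finrank_pi_fintype]
    exact Finset.sum_congr rfl fun k _ => (Submodule.finrank_quotient_add_finrank (B k)).symm
  rw [Finset.sum_add_distrib] at h3
  rw [hker] at h1
  have h4 := LinearMap.finrank_range_add_finrank_ker (L.domRestrict C)
  rw [LinearMap.range_domRestrict] at h4
  have h5 : finrank ℝ (L.domRestrict C).ker ≤ ∑ k, finrank ℝ (A k) := by
    rw [← Module.finrank_pi_fintype]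
    let J : (L.domRestrict C).ker →ₗ[ℝ] (∀ k, A k) := LinearMap.pi fun k =>
      ((LinearMap.proj k).comp (C.subtype.comp (L.domRestrict C).ker.subtype)).codRestrict (A k)
        fun ξ => hL _ ξ.1.2 ξ.2 k
    refine LinearMap.finrank_le_finrank_of_injective (f := J) ?_
    intro ξ ξ' h
    ext1; ext1; funext k
    exact congrArg Subtype.val (congrFun h k)
  have h6 : ∑ k, finrank ℝ (A k) + n ≤ ∑ k, finrank ℝ (B k) := by
    have : ∑ k : Fin n, (finrank ℝ (A k) + 1) ≤ ∑ k, finrank ℝ (B k) :=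
      Finset.sum_le_sum fun k _ => Submodule.finrank_lt_finrank_of_lt (hAB k)
    rw [Finset.sum_add_distrib] at this
    simpa using this
  omega

/-! ### Rigid subgraphs of a ring. -/

section
variable {n : ℕ} [NeZero n] {W : Fin n → Type*} {G : ∀ i, SimpleGraph (W i)}
  {a b c d : ∀ i, W i} {V : Type*} {Γ : SimpleGraph V} {φ : ∀ i, W i ↪ V}

/-- An edge of another member with both ends in member `k` would join the two vertices of a hinge,
which is a non-edge. -/
lemma IsRing.adj_of_adj (hr : IsRing G a b c d Γ φ) {k : Fin n} {x y : W k}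
    (h : Γ.Adj (φ k x) (φ k y)) : (G k).Adj x y := by
  obtain ⟨i, x', y', hxy, hx, hy⟩ := hr.adj_iff.1 h
  have hne := hxy.ne
  rcases hr.near (i := k) (j := i) (v := φ k x) ⟨x, rfl⟩ ⟨x', hx⟩ with rfl | rfl | rfl
  · rw [← (φ k).injective hx, ← (φ k).injective hy]
    exact hxy
  · have h1 := hr.eq_hinge (i := k) (v := φ (k + 1) x') ⟨x, hx.symm⟩ ⟨x', rfl⟩
    have h2 := hr.eq_hinge (i := k) (v := φ (k + 1) y') ⟨y, hy.symm⟩ ⟨y', rfl⟩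
    rw [hr.glue_ca, hr.glue_db] at h1 h2
    simp only [EmbeddingLike.apply_eq_iff_eq] at h1 h2
    have hn := hr.not_adj_ab (k + 1)
    rcases h1 with rfl | rfl <;> rcases h2 with rfl | rfl
    · exact absurd rfl hne
    · exact absurd hxy hn
    · exact absurd hxy.symm hn
    · exact absurd rfl hne
  · have h1 := hr.eq_hinge (i := i) (v := φ i x') ⟨x', rfl⟩ ⟨x, hx.symm⟩
    have h2 := hr.eq_hinge (i := i) (v := φ i y') ⟨y', rfl⟩ ⟨y, hy.symm⟩
    simp only [EmbeddingLike.apply_eq_iff_eq] at h1 h2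
    have hn := hr.not_adj_cd i
    rcases h1 with rfl | rfl <;> rcases h2 with rfl | rfl
    · exact absurd rfl hne
    · exact absurd hxy hn
    · exact absurd hxy.symm hn
    · exact absurd rfl hne

/-- A rigid subgraph of the ring on at least five vertices is not contained in one member. -/
lemma IsRing.not_subset_range [∀ i, Finite (W i)] (hr : IsRing G a b c d Γ φ) {k : Fin n}
    (hfree : NucleationFree (G k)) {H : Γ.Subgraph} (h5 : 5 ≤ H.verts.ncard)
    (hrig : IsRigid H.coe) : ¬ H.verts ⊆ Set.range (φ k) := by
  intro hsub
  have := hr.finite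
  let H' : (G k).Subgraph :=
    { verts := φ k ⁻¹' H.verts
      Adj := fun x y => H.Adj (φ k x) (φ k y)
      adj_sub := fun h => hr.adj_of_adj h.adj_sub
      edge_vert := fun h => H.edge_vert h
      symm := ⟨fun _ _ h => h.symm⟩ }
  have hbij : Function.Bijective
      (fun x : H'.verts => (⟨φ k x.1, x.2⟩ : H.verts)) := by
    constructor
    · intro x y h
      exact Subtype.ext ((φ k).injective (congrArg Subtype.val h))
    · rintro ⟨v, hv⟩
      obtain ⟨w, rfl⟩ := hsub hv
      exact ⟨⟨w, hv⟩, rfl⟩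
  let e : H'.coe ≃g H.coe :=
    { toEquiv := Equiv.ofBijective _ hbij
      map_rel_iff' := Iff.rfl }
  refine hfree H' ?_ (hrig.of_iso e)
  rwa [Set.ncard_preimage_of_injective_subset_range (φ k).injective hsub]

lemma IsRing.mem_motions_of_rigid_pieces (hr : IsRing G a b c d Γ φ) {H : Γ.Subgraph}
    {q : V → E3} {m : H.verts → E3}
    (h : ∀ k, ∃ ξ, ∀ u : H.verts, u.1 ∈ Set.range (φ k) → m u = rigidVelocity (q u) ξ) :
    m ∈ motions H.coe (fun v => q v) := by
  intro u v huv
  have huv' : Γ.Adj u v := H.adj_sub huv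
  obtain ⟨k, x, y, -, hx, hy⟩ := hr.adj_iff.1 huv'
  obtain ⟨ξ, hξ⟩ := h k
  rw [hξ u ⟨x, hx⟩, hξ v ⟨y, hy⟩]
  exact inner_sub_rigidVelocity_sub ξ _ _

/-- The rigid motions that fix the points of `s`. -/
noncomputable def stabilizer (q : V → E3) (s : Set V) : Submodule ℝ (E3 × E3) :=
  ⨅ v ∈ s, (rigidVelocity (q v)).ker

omit [NeZero n] in
lemma mem_stabilizer {q : V → E3} {s : Set V} {ξ : E3 × E3} :
    ξ ∈ stabilizer q s ↔ ∀ v ∈ s, rigidVelocity (q v) ξ = 0 := by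
  simp [stabilizer, Submodule.mem_iInf]

/-- A subgraph of the ring that meets all hinges has at least `n` degrees of freedom. -/
lemma IsRing.le_finrank_motions [∀ i, Finite (W i)] (hr : IsRing G a b c d Γ φ) (hn : 4 ≤ n)
    {H : Γ.Subgraph} {q : V → E3}
    (hq : ∀ o x y z : V, o ≠ x → o ≠ y → o ≠ z → x ≠ y → x ≠ z → y ≠ z →
      triple (q o) (q x) (q y) (q z) ≠ 0)
    (hH : ∀ k, φ k (c k) ∈ H.verts ∨ φ k (d k) ∈ H.verts) :
    n ≤ finrank ℝ (motions H.coe (fun v => q v)) := by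
  have := hr.finite
  choose i hi using hr.cover
  let A : Fin n → Submodule ℝ (E3 × E3) := fun k => stabilizer q (H.verts ∩ Set.range (φ k))
  let B : Fin n → Submodule ℝ (E3 × E3) := fun k =>
    stabilizer q (H.verts ∩ {φ k (c k), φ k (d k)})
  let C : Submodule ℝ (Fin n → E3 × E3) := ⨅ k, (B k).comap
    ((LinearMap.proj k : (Fin n → E3 × E3) →ₗ[ℝ] _) - LinearMap.proj (k + 1))
  let L : (Fin n → E3 × E3) →ₗ[ℝ] (H.verts → E3) :=
    LinearMap.pi fun v => (rigidVelocity (q v)).comp (LinearMap.proj (i v))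
  have hLa : ∀ ξ v, L ξ v = rigidVelocity (q v) (ξ (i v)) := fun _ _ => rfl
  have hC : ∀ ξ, ξ ∈ C ↔ ∀ k, ξ k - ξ (k + 1) ∈ B k := fun ξ => by
    simp only [C, Submodule.mem_iInf, Submodule.mem_comap, LinearMap.sub_apply,
      LinearMap.proj_apply]
  have hcons : ∀ ξ ∈ C, ∀ k, ∀ v ∈ H.verts, v ∈ Set.range (φ k) →
      v ∈ Set.range (φ (k + 1)) → rigidVelocity (q v) (ξ k) = rigidVelocity (q v) (ξ (k + 1)) := by
    intro ξ hξ k v hv hk hk'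
    have h1 := mem_stabilizer.1 ((hC ξ).1 hξ k) v ⟨hv, hr.eq_hinge hk hk'⟩
    rwa [map_sub, sub_eq_zero] at h1
  -- On `C` the choice of the member `i v` containing `v` does not matter.
  have hLk : ∀ ξ ∈ C, ∀ k (v : H.verts), v.1 ∈ Set.range (φ k) →
      L ξ v = rigidVelocity (q v) (ξ k) := by
    intro ξ hξ k v hk
    rw [hLa]
    have hv := hi v
    rcases hr.near hk hv with h | h | h
    · rw [← h]
    · rw [h] at hv ⊢
      exact (hcons ξ hξ k v v.2 hk hv).symm
    · have hk' := hk
      rw [h] at hk' ⊢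
      exact hcons ξ hξ _ v v.2 hv hk'
  -- The rotation about the hinge shared with the successor fixes that hinge but, by general
  -- position, moves the vertex of `H` on the hinge shared with the predecessor.
  have hAB : ∀ k, A k < B k := by
    intro k
    obtain ⟨j, rfl⟩ := fin_exists_pred k
    obtain ⟨n1, n2, n3, n4⟩ := hr.hinges_ne hn (j + 1)
    have hab := hr.ne_ab (j + 1)
    have hcd := hr.ne_cd (j + 1)
    have hinj := (φ (j + 1)).injective
    refine lt_of_le_of_ne ?_ fun heq => ?_
    · intro ξ hξ
      rw [mem_stabilizer] at hξ ⊢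
      rintro v ⟨hv, rfl | rfl⟩
      · exact hξ _ ⟨hv, ⟨_, rfl⟩⟩
      · exact hξ _ ⟨hv, ⟨_, rfl⟩⟩
    · have hmem : axisRotation (q (φ (j + 1) (c (j + 1)))) (q (φ (j + 1) (d (j + 1))))
          ∈ B (j + 1) := by
        rw [mem_stabilizer]
        rintro v ⟨hv, rfl | rfl⟩
        · exact rigidVelocity_axisRotation_left _ _
        · exact rigidVelocity_axisRotation_right _ _
      rw [← heq, mem_stabilizer] at hmem
      have h1 := hH j
      rw [hr.glue_ca, hr.glue_db] at h1
      rcases h1 with h1 | h1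
      · refine rigidVelocity_axisRotation_ne_zero
          (hq _ (φ (j + 1) (b (j + 1))) _ _ ?_ ?_ ?_ ?_ ?_ ?_)
          (hmem _ ⟨h1, ⟨_, rfl⟩⟩) <;> refine hinj.ne ?_
        exacts [n3.symm, hcd, n1.symm, n4, hab.symm, n2.symm]
      · refine rigidVelocity_axisRotation_ne_zero
          (hq _ (φ (j + 1) (a (j + 1))) _ _ ?_ ?_ ?_ ?_ ?_ ?_)
          (hmem _ ⟨h1, ⟨_, rfl⟩⟩) <;> refine hinj.ne ?_
        exacts [n1.symm, hcd, n3.symm, n2, hab, n4.symm]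
  refine (le_finrank_map_of_cyclic hAB L C hC ?_).trans (Submodule.finrank_mono ?_)
  · intro ξ hξ h0 k
    refine mem_stabilizer.2 fun v ⟨hv, hk⟩ => ?_
    rw [← hLk ξ hξ k ⟨v, hv⟩ hk, h0]
    rfl
  · rintro _ ⟨ξ, hξ, rfl⟩
    exact hr.mem_motions_of_rigid_pieces fun k => ⟨ξ k, fun u hu => hLk ξ hξ k u hu⟩

open Fin.CommRing in
/-- A rigid subgraph of the ring that misses a hinge is contained in one member. -/
lemma IsRing.subset_range_of_missing_hinge [∀ i, Finite (W i)] (hr : IsRing G a b c d Γ φ)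
    {H : Γ.Subgraph} {q : V → E3}
    (hq : ∀ o x y z : V, o ≠ x → o ≠ y → o ≠ z → x ≠ y → x ≠ z → y ≠ z →
      triple (q o) (q x) (q y) (q z) ≠ 0)
    (hstretch : ∀ m ∈ motions H.coe (fun v => q v), ∀ u v : H.verts,
      stretch (fun v : H.verts => q v) m u v = 0)
    {j : Fin n} (hj : φ j (c j) ∉ H.verts ∧ φ j (d j) ∉ H.verts) :
    ∃ k, H.verts ⊆ Set.range (φ k) := by
  classical
  have hn0 : 0 < n := Nat.pos_of_ne_zero (NeZero.ne n)
  -- The ring is cut open at the missing hinge: `P 0` is the member after it and `P (n - 1) = j`.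
  let P : ℕ → Fin n := fun t => j + 1 + (t : Fin n)
  have hPs : ∀ t, P (t + 1) = P t + 1 := fun t => by simp [P, add_assoc]
  have hPeq : ∀ s t, P s = P t → s % n = t % n := by
    intro s t h
    have h1 : (s : Fin n) = (t : Fin n) := add_left_cancel h
    simpa [Fin.ext_iff] using h1
  have hPsurj : ∀ k, ∃ t < n, P t = k := fun k =>
    ⟨(k - (j + 1)).val, Fin.isLt _, by simp only [P, Fin.cast_val_eq_self]; abel⟩
  -- members with a common vertex in `H` are neighbours along the cut ring
  have hnear : ∀ {v s t}, v ∈ H.verts → s < t → t < n → v ∈ Set.range (φ (P s)) →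
      v ∈ Set.range (φ (P t)) → t = s + 1 := by
    intro v s t hv hst ht h1 h2
    rcases hr.near h1 h2 with h | h | h
    · have := hPeq _ _ h
      rw [Nat.mod_eq_of_lt (hst.trans ht), Nat.mod_eq_of_lt ht] at this
      omega
    · rw [← hPs] at h
      have := hPeq _ _ h
      rwa [Nat.mod_eq_of_lt ht, Nat.mod_eq_of_lt (by omega)] at this
    · exfalso
      have h' := h
      rw [← hPs] at h'
      have h3 := hPeq _ _ h'
      rw [Nat.mod_eq_of_lt (hst.trans ht)] at h3
      have htn : t + 1 = n := by
        by_contra hne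
        rw [Nat.mod_eq_of_lt (by omega)] at h3
        omega
      rw [htn, Nat.mod_self] at h3
      have hP0 : P s = j + 1 := by simp [P, h3]
      have hPt : P t = j := add_right_cancel (h.symm.trans hP0)
      rw [hP0] at h1
      rw [hPt] at h2
      rcases hr.eq_hinge h2 h1 with h | h
      · exact hj.1 (h ▸ hv)
      · exact hj.2 (h ▸ hv)
  let Left : ℕ → V → Prop := fun t v => ∃ s ≤ t, v ∈ Set.range (φ (P s))
  let Right : ℕ → V → Prop := fun t v => ∃ s, t < s ∧ s < n ∧ v ∈ Set.range (φ (P s))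
  -- If `H` had a vertex strictly on each side of hinge `P t`, rotating the right side about that
  -- hinge would be a motion of `H` that stretches this pair.
  have hcut : ∀ t, t + 1 < n →
      (∀ v ∈ H.verts, Left t v) ∨ (∀ v ∈ H.verts, Right t v) := by
    intro t ht
    by_contra hcon
    push Not at hcon
    obtain ⟨⟨r, hrH, hrL⟩, ⟨l, hlH, hlR⟩⟩ := hcon
    have hLR : ∀ v, Left t v ∨ Right t v := by
      intro v
      obtain ⟨k, hk⟩ := hr.cover v
      obtain ⟨s, hs, rfl⟩ := hPsurj k
      rcases le_or_gt s t with h | h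
      · exact Or.inl ⟨s, h, hk⟩
      · exact Or.inr ⟨s, h, hs, hk⟩
    have hboth : ∀ v ∈ H.verts, Left t v → Right t v →
        v = φ (P t) (c (P t)) ∨ v = φ (P t) (d (P t)) := by
      rintro v hv ⟨s, hs, h1⟩ ⟨s', hs', hsn, h2⟩
      have := hnear hv (hs.trans_lt hs') hsn h1 h2
      have hst : s = t := by omega
      have hst' : s' = t + 1 := by omega
      subst hst hst'
      rw [hPs] at h2
      exact hr.eq_hinge h1 h2
    have hhinge : (Left t (φ (P t) (c (P t))) ∧ Right t (φ (P t) (c (P t)))) ∧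
        (Left t (φ (P t) (d (P t))) ∧ Right t (φ (P t) (d (P t)))) := by
      obtain ⟨⟨h1, h2⟩, -⟩ := hr.glue_mem (P t)
      rw [← hPs] at h1 h2
      exact ⟨⟨⟨t, le_rfl, ⟨_, rfl⟩⟩, ⟨t + 1, by omega, ht, h1⟩⟩,
        ⟨⟨t, le_rfl, ⟨_, rfl⟩⟩, ⟨t + 1, by omega, ht, h2⟩⟩⟩
    have hrR : Right t r := (hLR r).resolve_left hrL
    set o := φ (P t) (c (P t)) with ho
    set y := φ (P t) (d (P t)) with hy
    let m : H.verts → E3 := fun v =>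
      if Right t v then rigidVelocity (q v) (axisRotation (q o) (q y)) else 0
    have hm : m ∈ motions H.coe (fun v => q v) := by
      refine hr.mem_motions_of_rigid_pieces fun k => ?_
      obtain ⟨s, hs, rfl⟩ := hPsurj k
      rcases le_or_gt s t with h | h
      · refine ⟨0, fun u hu => ?_⟩
        rw [map_zero]
        by_cases hR : Right t u
        · simp only [m, if_pos hR]
          rcases hboth u u.2 ⟨s, h, hu⟩ hR with h | h <;> rw [h]
          · exact rigidVelocity_axisRotation_left _ _
          · exact rigidVelocity_axisRotation_right _ _
        · simp only [m, if_neg hR]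
      · refine ⟨axisRotation (q o) (q y), fun u hu => ?_⟩
        have hR : Right t u := ⟨s, h, hs, hu⟩
        simp only [m, if_pos hR]
    have h0 := hstretch m hm ⟨l, hlH⟩ ⟨r, hrH⟩
    simp only [stretch, m, if_pos hrR, if_neg hlR] at h0
    rw [inner_sub_axisRotation, neg_eq_zero] at h0
    refine hq o l y r ?_ ?_ ?_ ?_ ?_ ?_ h0
    · rintro rfl; exact hlR hhinge.1.2
    · exact (φ (P t)).injective.ne (hr.ne_cd _)
    · rintro rfl; exact hrL hhinge.1.1
    · rintro rfl; exact hlR hhinge.2.2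
    · rintro rfl; exact hlR hrR
    · rintro rfl; exact hrL hhinge.2.1
  have hex : ∃ t, ∀ v ∈ H.verts, Left t v := by
    refine ⟨n, fun v _ => ?_⟩
    obtain ⟨k, hk⟩ := hr.cover v
    obtain ⟨s, hs, rfl⟩ := hPsurj k
    exact ⟨s, hs.le, hk⟩
  have htl := Nat.find_spec hex
  have hmin := fun t => Nat.find_min (m := t) hex
  have hle : Nat.find hex ≤ n - 1 := by
    -- At the least `t` with everything in `Left t`, minimality and `hcut` put everything in `Right
    -- (t - 1)` as well, which leaves only the member `P t`.
    refine Nat.find_min' hex fun v _ => ?_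
    obtain ⟨k, hk⟩ := hr.cover v
    obtain ⟨s, hs, rfl⟩ := hPsurj k
    exact ⟨s, by omega, hk⟩
  generalize Nat.find hex = t at htl hmin hle
  refine ⟨P t, fun v hv => ?_⟩
  obtain ⟨s, hs, h1⟩ := htl v hv
  rcases Nat.eq_zero_or_pos t with rfl | htpos
  · rwa [Nat.le_zero.1 hs] at h1
  obtain ⟨s', hs', hsn, h2⟩ := ((hcut (t - 1) (by omega)).resolve_left (hmin _ (by omega))) v hv
  rcases eq_or_lt_of_le hs with rfl | hlt
  · exact h1
  have := hnear hv (by omega) hsn h1 h2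
  have hst : s' = t := by omega
  exact hst ▸ h2

/-- A ring of at least seven nucleation-free graphs is nucleation-free. -/
theorem IsRing.nucleationFree [∀ i, Finite (W i)] (hr : IsRing G a b c d Γ φ) (hn : 7 ≤ n)
    (hfree : ∀ i, NucleationFree (G i)) : NucleationFree Γ := by
  intro H h5 hrig
  have := hr.finite
  have := Fintype.ofFinite H.verts
  obtain ⟨p, hp, -⟩ := id hrig
  obtain ⟨q, hq, hgp⟩ := exists_generic_general_position hp
  have hcard : 5 ≤ Fintype.card H.verts := by rwa [← Nat.card_eq_fintype_card]
  have h6 := hrig.finrank_motions_le hcard hq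
  by_cases hH : ∀ k, φ k (c k) ∈ H.verts ∨ φ k (d k) ∈ H.verts
  · have := hr.le_finrank_motions (by omega) hgp hH
    omega
  push Not at hH
  obtain ⟨j, hj⟩ := hH
  obtain ⟨f⟩ : Nonempty (Fin 5 ↪ H.verts) := Function.Embedding.nonempty_of_card_le (by simpa)
  have hf : ∀ i j : Fin 5, i ≠ j → (f i : V) ≠ f j := fun i j h =>
    Subtype.val_injective.ne (f.injective.ne h)
  obtain ⟨k, hk⟩ := hr.subset_range_of_missing_hinge hgp (fun m hm u v =>
    stretch_eq_zero_of_finrank_le h6 (o := f 0) (x := f 1) (y := f 2) (z := f 3)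
      (hgp _ _ _ _ (hf _ _ (by decide)) (hf _ _ (by decide)) (hf _ _ (by decide))
        (hf _ _ (by decide)) (hf _ _ (by decide)) (hf _ _ (by decide))) hm u v) hj
  exact hr.not_subset_range (hfree k) h5 hrig hk

end

end Rigidity3D

theorem theorem3p1 {n : ℕ} [NeZero n] (hn : 7 ≤ n)
    {W : Fin n → Type*} [∀ i, Finite (W i)]
    (G : ∀ i, SimpleGraph (W i)) (a b c d : ∀ i, W i)
    {V : Type*} (Γ : SimpleGraph V) (φ : ∀ i, W i ↪ V)
    (hring : IsRing G a b c d Γ φ)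
    (hfree : ∀ i, NucleationFree (G i))
    (hsign : ∃ i₀, HasExpansiveContractive (G i₀) (a i₀) (b i₀) (c i₀) (d i₀) ∧
      ∀ i, i ≠ i₀ → HasExpansiveExpansive (G i) (a i) (b i) (c i) (d i)) :
    NucleationFree Γ ∧ ∀ i, IsImpliedNonEdge Γ (φ i (c i)) (φ i (d i)) := by
  refine ⟨hring.nucleationFree hn hfree, fun i => ⟨(φ i).injective.ne (hring.ne_cd i),
    fun h => hring.not_adj_cd i (hring.adj_of_adj h), fun p hp => ?_⟩⟩
  obtain ⟨i₀, h₀, h₁⟩ := hsign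
  let ε : Fin n → ℤˣ := fun k => if k = i₀ then -1 else 1
  have key : ∀ k, ∃ p : W k → E3, IsGeneric (addHinges (G k) (a k) (b k) (c k) (d k)) p ∧
      (∀ m ∈ motions (G k) p, stretch p m (a k) (b k) = 0 ↔ stretch p m (c k) (d k) = 0) ∧
      HasSign (G k) (a k) (b k) (c k) (d k) (ε k) p := by
    intro k
    by_cases hk : k = i₀
    · subst hk
      obtain ⟨p, hp, hs⟩ := h₀
      exact ⟨p, hp, hasSign_of_pos_iff fun m hm => by simpa [ε] using hs m hm⟩
    · obtain ⟨p, hp, hs⟩ := h₁ k hk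
      exact ⟨p, hp, hasSign_of_pos_iff fun m hm => by simpa [ε, hk] using hs m hm⟩
  choose p₀ hgen hzero hs using key
  refine hring.rigidityRow_mem (by omega) hgen hzero hs ?_ hp i
  simp [ε, Finset.prod_ite_eq']
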